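/- Setting. Let $d\in\{2,3\}$, $0\le\alpha<k$ integers and $\square\in\{\mathrm{RT},\mathrm{N},\mathrm{TH}\}$. Predomains $\Omega_i^*=\mathbf F_i((0,1)^d)\subset\mathbb R^d$, $0\le i\le N$, are open images of the cube under maps $\mathbf F_i$ that are bi-Lipschitz on $[0,1]^d$ and whose components are tensor-product splines of degree $k$ and regularity $C^\alpha$ at the interior breakpoints of a Cartesian mesh $\hat{\mathcal M}_{h,i}$ of $(0,1)^d$. Elements of patch $i$ are $K=\mathbf F_i(Q)$, $Q\in\hat{\mathcal M}_{h,i}$, with size $h_K=\operatorname{diam}K$. Put $$\Omega_i=\Omega_i^*\setminus\bigcup_{l>i}\overline{\Omega_l^*},\qquad \Gamma_i=\partial\Omega_i^*\setminus\bigcup_{l>i}\overline{\Omega_l^*},\qquad \Gamma_{ij}=\Gamma_i\cap\overline{\Omega_j}\quad(j<i).$$ The active mesh is $\mathcal M_i=\{K\text{ of patch }i: K\cap\Omega_i\ne\emptyset\}$, and $N_\Gamma$ is the larger of $\max_i\#\{j<i:\Gamma_{ij}\ne\emptyset\}$ and $\max_j\#\{i>j:\Gamma_{ij}\neq\emptyset\}$.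 On $\Gamma_{ij}$, $\mathsf h$ is the trace of the piecewise constant mesh size function $h_K$ of one of the two meshes $\mathcal M_i,\mathcal M_j$ (a fixed choice for each interface). Discrete spaces. Let $\hat Q_{h,i}$ be the splines of degree $k$ and regularity $\alpha$ in every direction. Let $\hat V_{h,i}$ consist of vector fields whose $l$-th component is a spline of the following type: for RT, degree $k+1$ and regularity $\alpha+1$ in direction $l$, degree $k$ and regularity $\alpha$ in the others; for N, degree $k+1$ in all directions, regularity $\alpha+1$ in direction $l$ and $\alpha$ in the others; for TH, degree $k+1$ and regularity $\alpha$ in all directions. On $\Omega_i^*$, velocities are the $\mathbf v$ with $\det(D\mathbf F_i)D\mathbf F_i^{-1}(\mathbf v\circ\mathbf F_i)\in\hat V_{h,i}$ (RT, N) or $\mathbf v\circ\mathbf F_i\in\hat V_{h,i}$ (TH), and pressures are the $q$ with $\det(D\mathbf F_i)(q\circ\mathbf F_i)\in\hat Q_{h,i}$ (RT, N) or $q\circ\mathbf F_i\in\hat Q_{h,i}$ (TH). Their restrictions to $\Omega_i$ form $V_{h,i}$ and $Q_{h,i}$, and $V_h=\bigoplus_iV_{h,i}$, $Q_h=\bigoplus_iQ_{h,i}$.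 No boundary conditions are imposed. Stabilized pressures. Fix $\theta\in(0,1]$ and $R$. An element $K\in\mathcal M_i$ is good if $|\Omega_i\cap K|\ge\theta|K|$, and bad otherwise. Each bad $K\in\mathcal M_i$ is assigned a good element $K'\ne K$ with $\operatorname{dist}(K,K')\le R\,h_K$, lying in $\mathcal M_m$ for the smallest index $m\ge i$ for which $\mathcal M_m$ contains such an element. $\overline Q_h$ is the set of functions that coincide, for some $q_h\in Q_h$, with $q_h$ on the visible part of each good element, and on the visible part of each bad $K$ with the polynomial extension of the $L^2(K')$-orthogonal projection of $q_m|_{K'}$ onto the polynomials of degree at most $k$ in each variable ($m$ being the patch of $K'$ and $q_m$ being taken on the whole of $K'$). Norms and form. With $[\cdot]$ the jump $(\cdot)_i-(\cdot)_j$ of the traces on $\Gamma_{ij}$, and $D\mathbf v_i$, $\operatorname{div}\mathbf v_i$ taken elementwise, $$\|\mathbf v\|_{1,h}^2=\sum_i\|D\mathbf v_i\|^2_{L^2(\Omega_i)}+\sum_{j<i}\|\mathsf h^{-1/2}[\mathbf v]\|^2_{L^2(\Gamma_{ij})},\qquad \|q\|_{0,h}^2=\sum_i\|q_i\|^2_{L^2(\Omega_i)}+\sum_{j<i}\|\mathsf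 h^{1/2}[q]\|^2_{L^2(\Gamma_{ij})},$$ $$\|\mathbf v_i\|_{1,h,i}^2=\|D\mathbf v_i\|^2_{L^2(\Omega_i)}+\sum_{l>i}\|\mathsf h^{-1/2}\mathbf v_i\|^2_{L^2(\Gamma_{li})}+\sum_{j<i}\|\mathsf h^{-1/2}\mathbf v_i\|^2_{L^2(\Gamma_{ij})},\qquad b_0(\mathbf v,q)=-\sum_i\int_{\Omega_i}q_i\operatorname{div}\mathbf v_i .$$ Constants. For a configuration, let $L,\kappa,c>0,C,\sigma,n_\Gamma,m$ be such that: every $\mathbf F_i$ is bi-Lipschitz on $[0,1]^d$ with constant $L$; the diameter of each parametric element is at most $\kappa$ times each of its edges; $c\,h_{K_j}\le h_{K_i}\le C\,h_{K_j}$ whenever $j<i$, $K_i\in\mathcal M_i$, $K_j\in\mathcal M_j$ and both closures meet $\Gamma_{ij}$; $h_K\le\sigma h_{K'}$ for each bad $K$ with assigned good element $K'$; no element is assigned to more than $m$ bad elements; $N_\Gamma\le n_\Gamma$. Lemma. Let $d,\square,k,\alpha,\theta,R,L,\kappa,c,C,\sigma,n_\Gamma,m$ and $\beta>0$ be given. There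 is $\beta_0>0$, depending only on these data, such that the following holds for every number of patches, every configuration as above with these constants and every admissible assignment of good elements. If for every $0\le i\le N$ $$\sup_{\mathbf v_i\in V_{h,i}}\frac{\int_{\Omega_i}q_i\operatorname{div}\mathbf v_i}{\|\mathbf v_i\|_{1,h,i}}\ \ge\ \beta\,\|q_i\|_{L^2(\Omega_i)}\qquad\text{for all }q_i\in\overline Q_h|_{\Omega_i},$$ then $$\inf_{q_h\in\overline Q_h}\ \sup_{\mathbf v_h\in V_h}\frac{b_0(\mathbf v_h,q_h)}{\|\mathbf v_h\|_{1,h}\,\|q_h\|_{0,h}}\ \ge\ \beta_0 .$$ (Infimum and suprema are over elements of nonzero norm.) -/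

import Mathlib

open MeasureTheory Set Filter Topology
open scoped NNReal ENNReal Polynomial

noncomputable section

namespace OverlapStokes

/-- Euclidean space `ℝ^d`. -/
abbrev E (d : ℕ) : Type := EuclideanSpace ℝ (Fin d)

/-- The `l`-th standard basis vector of `ℝ^d`. -/
def e {d : ℕ} (l : Fin d) : E d := EuclideanSpace.single l 1

/-- Closed parametric domain `[0,1]^d`. -/
def closedCube (d : ℕ) : Set (E d) := {ξ | ∀ l, ξ l ∈ Icc (0 : ℝ) 1}

/-- Open parametric domain `(0,1)^d`. -/
def openCube (d : ℕ) : Set (E d) := {ξ | ∀ l, ξ l ∈ Ioo (0 : ℝ) 1}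

/-! ### Spline spaces -/

/-- Univariate splines on `[0,1]` with breakpoints `0 = ζ 0 < ... < ζ n = 1`: piecewise polynomials
of degree at most `k` with `r` continuous derivatives at every interior breakpoint (the values
outside `[0,1]` are irrelevant and unconstrained). -/
def IsUnivariateSpline {n : ℕ} (ζ : Fin (n + 1) → ℝ) (k r : ℕ) (s : ℝ → ℝ) : Prop :=
  ContDiffOn ℝ (r : WithTop ℕ∞) s (Icc 0 1) ∧
    ∀ j : Fin n, ∃ p : ℝ[X], p.natDegree ≤ k ∧
      EqOn s (fun t => p.eval t) (Icc (ζ j.castSucc) (ζ j.succ))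

/-- The tensor product spline space with degree `k l` and regularity `r l` in direction `l`. -/
def splineSpace {d : ℕ} {n : Fin d → ℕ} (ζ : ∀ l, Fin (n l + 1) → ℝ) (k r : Fin d → ℕ) :
    Submodule ℝ (E d → ℝ) :=
  Submodule.span ℝ {f | ∃ s : Fin d → ℝ → ℝ,
    (∀ l, IsUnivariateSpline (ζ l) (k l) (r l) (s l)) ∧ ∀ ξ, f ξ = ∏ l, s l (ξ l)}

/-- The three families of isogeometric velocity/pressure pairs: Raviart-Thomas, Nedelec,
Taylor-Hood. -/
inductive ElementType where
  | RT
  | N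
  | TH

/-- Degree, in direction `m`, of the `l`-th component of the parametric velocities. -/
def ElementType.velDegree {d : ℕ} (t : ElementType) (k : ℕ) (l m : Fin d) : ℕ :=
  match t with
  | .RT => if m = l then k + 1 else k
  | .N => k + 1
  | .TH => k + 1

/-- Regularity, in direction `m`, of the `l`-th component of the parametric velocities. -/
def ElementType.velRegularity {d : ℕ} (t : ElementType) (α : ℕ) (l m : Fin d) : ℕ :=
  match t with
  | .RT => if m = l then α + 1 else α
  | .N => if m = l then α + 1 else α
  | .TH => α

/-! ### A single spline patch (predomain) -/

/-- A predomain: a tensor product mesh of the parametric domain and a spline parametrization `F` of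
degree `k` and regularity `α` whose image of `(0,1)^d` is open. -/
structure Patch (d k α : ℕ) where
  /-- number of knot spans in each direction -/
  n : Fin d → ℕ
  /-- breakpoints in each direction -/
  ζ : ∀ l, Fin (n l + 1) → ℝ
  ζ_strictMono : ∀ l, StrictMono (ζ l)
  ζ_zero : ∀ l, ζ l 0 = 0
  ζ_last : ∀ l, ζ l (Fin.last (n l)) = 1
  /-- the parametrization; only its values on `[0,1]^d` matter -/
  F : E d → E d
  F_mem : ∀ l, (fun ξ => F ξ l) ∈ splineSpace ζ (fun _ => k) (fun _ => α)
  isOpen_image : IsOpen (F '' openCube d)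

namespace Patch

/-- Multi-indices of the elements of the mesh. -/
abbrev Idx {d k α : ℕ} (P : Patch d k α) : Type := ∀ l : Fin d, Fin (P.n l)

/-- The predomain `Ω* = F((0,1)^d)`. -/
def domain {d k α : ℕ} (P : Patch d k α) : Set (E d) := P.F '' openCube d

/-- Parametric (open) Bezier element. -/
def paramElem {d k α : ℕ} (P : Patch d k α) (J : P.Idx) : Set (E d) :=
  {ξ | ∀ l, ξ l ∈ Ioo (P.ζ l (J l).castSucc) (P.ζ l (J l).succ)}

/-- Physical (open) Bezier element, an element of the premesh. -/
def elem {d k α : ℕ} (P : Patch d k α) (J : P.Idx) : Set (E d) := P.F '' P.paramElem J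

/-- The parametrization is bi-Lipschitz on `[0,1]^d` with constant `L`. -/
def BiLipschitz {d k α : ℕ} (P : Patch d k α) (L : ℝ) : Prop :=
  ∀ ξ ∈ closedCube d, ∀ η ∈ closedCube d,
    dist (P.F ξ) (P.F η) ≤ L * dist ξ η ∧ dist ξ η ≤ L * dist (P.F ξ) (P.F η)

/-- Shape regularity of the parametric mesh with constant `κ`: the diameter of each element is at
most `κ` times each of its edges. -/
def ShapeRegular {d k α : ℕ} (P : Patch d k α) (κ : ℝ) : Prop :=
  ∀ (J : P.Idx) (l : Fin d),
    Metric.diam (P.paramElem J) ≤ κ * (P.ζ l (J l).succ - P.ζ l (J l).castSucc)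

/-- Parametric velocities. -/
def paramVel {d k α : ℕ} (P : Patch d k α) (t : ElementType) : Set (E d → E d) :=
  {w | ∀ l, (fun ξ => w ξ l) ∈ splineSpace P.ζ (t.velDegree k l) (t.velRegularity α l)}

/-- Parametric pressures. -/
def paramPres {d k α : ℕ} (P : Patch d k α) : Set (E d → ℝ) :=
  {p | p ∈ splineSpace P.ζ (fun _ => k) (fun _ => α)}

/-- The pull-back of a velocity at the parametric point `ξ`: the contravariant Piola transform
`det(DF) DF⁻¹ (v ∘ F)` for Raviart-Thomas and Nedelec, composition with `F` for Taylor-Hood. -/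
def pullVel {d k α : ℕ} (P : Patch d k α) (t : ElementType) (v : E d → E d) (ξ : E d) : E d :=
  match t with
  | .RT => (fderiv ℝ P.F ξ).det • (fderiv ℝ P.F ξ).inverse (v (P.F ξ))
  | .N => (fderiv ℝ P.F ξ).det • (fderiv ℝ P.F ξ).inverse (v (P.F ξ))
  | .TH => v (P.F ξ)

/-- The pull-back of a pressure: `det(DF) (q ∘ F)` for Raviart-Thomas and Nedelec, composition with
`F` for Taylor-Hood. -/
def pullPres {d k α : ℕ} (P : Patch d k α) (t : ElementType) (q : E d → ℝ) (ξ : E d) : ℝ :=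
  match t with
  | .RT => (fderiv ℝ P.F ξ).det * q (P.F ξ)
  | .N => (fderiv ℝ P.F ξ).det * q (P.F ξ)
  | .TH => q (P.F ξ)

/-- Velocities on the predomain: the pull-back is, inside every element (that is, up to the mesh
skeleton, a null set), a parametric velocity. -/
def velStar {d k α : ℕ} (P : Patch d k α) (t : ElementType) : Set (E d → E d) :=
  {v | ∃ w ∈ P.paramVel t, ∀ J, EqOn (P.pullVel t v) w (P.paramElem J)}

/-- Pressures on the predomain. -/
def presStar {d k α : ℕ} (P : Patch d k α) (t : ElementType) : Set (E d → ℝ) :=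
  {q | ∃ p ∈ P.paramPres, ∀ J, EqOn (P.pullPres t q) p (P.paramElem J)}

end Patch

/-! ### Polynomials on physical elements -/

/-- `r` is (the function of) a polynomial of degree at most `k` in each variable. -/
def IsTensorPoly {d : ℕ} (k : ℕ) (r : E d → ℝ) : Prop :=
  ∃ p : MvPolynomial (Fin d) ℝ, (∀ l, p.degreeOf l ≤ k) ∧
    ∀ x, r x = MvPolynomial.eval (fun l => x l) p

/-- `r` is the canonical extension to `ℝ^d` of the `L²(K)`-orthogonal projection of `q` onto the
polynomials of degree at most `k` in each variable. -/
def IsL2Proj {d : ℕ} (k : ℕ) (K : Set (E d)) (q r : E d → ℝ) : Prop :=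
  IsTensorPoly k r ∧ ∀ s, IsTensorPoly k s → ∫ x in K, (q x - r x) * s x = 0

/-- The divergence of a velocity field at a point. -/
def divergence {d : ℕ} (v : E d → E d) (x : E d) : ℝ := ∑ l, (fderiv ℝ v x (e l)) l

/-! ### Overlapping patches -/

/-- `N + 1` predomains, the `i`-th lying on top of the `j`-th one when `j < i`. The flag
`lowerSize i j` records, for `j < i`, whether the mesh size on the interface `Γ i j` is the trace of
the mesh size function of the lower patch `j` or of the upper patch `i`. -/
structure Overlap (d k α N : ℕ) where
  patch : Fin (N + 1) → Patch d k α
  lowerSize : Fin (N + 1) → Fin (N + 1) → Bool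

namespace Overlap

/-- The set of all elements of all premeshes. -/
abbrev Elem {d k α N : ℕ} (D : Overlap d k α N) : Type := Σ i : Fin (N + 1), (D.patch i).Idx

/-- The physical element belonging to an index. -/
def cell {d k α N : ℕ} (D : Overlap d k α N) (a : D.Elem) : Set (E d) := (D.patch a.1).elem a.2

/-- The diameter of the whole element. -/
def size {d k α N : ℕ} (D : Overlap d k α N) (a : D.Elem) : ℝ := Metric.diam (D.cell a)

/-- The visible part `Ω i` of the `i`-th predomain. -/
def visible {d k α N : ℕ} (D : Overlap d k α N) (i : Fin (N + 1)) : Set (E d) :=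
  (D.patch i).domain \ ⋃ l ∈ Ioi i, closure (D.patch l).domain

/-- The visible part `Γ i` of the boundary of the `i`-th predomain. -/
def bdry {d k α N : ℕ} (D : Overlap d k α N) (i : Fin (N + 1)) : Set (E d) :=
  frontier (D.patch i).domain \ ⋃ l ∈ Ioi i, closure (D.patch l).domain

/-- The local interface `Γ i j`, used for `j < i`. -/
def iface {d k α N : ℕ} (D : Overlap d k α N) (i j : Fin (N + 1)) : Set (E d) :=
  D.bdry i ∩ closure (D.visible j)

open Classical in
/-- The maximum number of boundary overlaps `N_Γ`. -/
def numOverlaps {d k α N : ℕ} (D : Overlap d k α N) : ℕ :=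
  max (Finset.univ.sup fun i => (Finset.univ.filter fun j => j < i ∧ (D.iface i j).Nonempty).card)
    (Finset.univ.sup fun j => (Finset.univ.filter fun i => j < i ∧ (D.iface i j).Nonempty).card)

/-- Elements of the active meshes. -/
def IsActive {d k α N : ℕ} (D : Overlap d k α N) (a : D.Elem) : Prop :=
  (D.cell a ∩ D.visible a.1).Nonempty

/-- Good elements: active elements whose visible area ratio is at least `θ`. -/
def IsGood {d k α N : ℕ} (D : Overlap d k α N) (θ : ℝ) (a : D.Elem) : Prop :=
  D.IsActive a ∧ ENNReal.ofReal θ ≤ volume (D.visible a.1 ∩ D.cell a) / volume (D.cell a)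

/-- Bad elements: active elements that are not good. -/
def IsBad {d k α N : ℕ} (D : Overlap d k α N) (θ : ℝ) (a : D.Elem) : Prop :=
  D.IsActive a ∧ ¬ D.IsGood θ a

/-- `b` is a neighbor of `a`: a different active element at distance at most `R` times the size
of `a`. -/
def IsNeighbor {d k α N : ℕ} (D : Overlap d k α N) (R : ℝ) (a b : D.Elem) : Prop :=
  D.IsActive b ∧ b ≠ a ∧
    ⨅ x ∈ D.cell a, Metric.infEDist x (D.cell b) ≤ ENNReal.ofReal (R * D.size a)

/-- `nb` is a possible output of the good neighbor search: it sends each bad element `a` of the mesh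
`i` to a good neighbor of `a` in the mesh with the smallest possible index `≥ i`. -/
def IsGoodNeighborMap {d k α N : ℕ} (D : Overlap d k α N) (θ R : ℝ) (nb : D.Elem → D.Elem) : Prop :=
  ∀ a, D.IsBad θ a → a.1 ≤ (nb a).1 ∧ D.IsGood θ (nb a) ∧ D.IsNeighbor R a (nb a) ∧
    ∀ b, a.1 ≤ b.1 → D.IsGood θ b → D.IsNeighbor R a b → (nb a).1 ≤ b.1

/-- Meshes meeting at a common interface have comparable sizes. -/
def CompatibleSizes {d k α N : ℕ} (D : Overlap d k α N) (c C : ℝ) : Prop :=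
  ∀ a b : D.Elem, b.1 < a.1 → D.IsActive a → D.IsActive b →
    (closure (D.cell a) ∩ D.iface a.1 b.1).Nonempty →
    (closure (D.cell b) ∩ D.iface a.1 b.1).Nonempty →
    c * D.size b ≤ D.size a ∧ D.size a ≤ C * D.size b

/-- The size of a bad element is at most `σ` times that of its good neighbor, and no element is the
good neighbor of more than `m` bad elements. -/
def NeighborBounds {d k α N : ℕ} (D : Overlap d k α N) (θ : ℝ) (nb : D.Elem → D.Elem) (σ : ℝ)
    (m : ℕ) : Prop :=
  (∀ a, D.IsBad θ a → D.size a ≤ σ * D.size (nb a)) ∧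
    ∀ b, {a | D.IsBad θ a ∧ nb a = b}.ncard ≤ m

/-! ### Discrete spaces -/

/-- Local velocity space `V_{h,i}` on the visible part. -/
def velSpace {d k α N : ℕ} (D : Overlap d k α N) (t : ElementType) (i : Fin (N + 1)) :
    Set (E d → E d) :=
  {w | ∃ v ∈ (D.patch i).velStar t, EqOn w v (D.visible i)}

/-- Union velocity space `V_h`, whose elements are tuples. -/
def vel {d k α N : ℕ} (D : Overlap d k α N) (t : ElementType) : Set (Fin (N + 1) → E d → E d) :=
  {v | ∀ i, v i ∈ D.velSpace t i}

/-- Stabilized pressure space: on good elements a stabilized pressure is a discrete pressure `q`, on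
a bad element it is the extension of the projected values of `q` on the associated good neighbor.
(The values of `q` on a good element are determined by its values on the visible part.) -/
def stabPres {d k α N : ℕ} (D : Overlap d k α N) (t : ElementType) (θ : ℝ) (nb : D.Elem → D.Elem) :
    Set (Fin (N + 1) → E d → ℝ) :=
  {φ | ∃ q : Fin (N + 1) → E d → ℝ, (∀ i, q i ∈ (D.patch i).presStar t) ∧
    (∀ a, D.IsGood θ a → EqOn (φ a.1) (q a.1) (D.cell a ∩ D.visible a.1)) ∧
    (∀ a, D.IsBad θ a → ∃ r, IsL2Proj k (D.cell (nb a)) (q (nb a).1) r ∧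
      EqOn (φ a.1) r (D.cell a ∩ D.visible a.1))}

/-! ### Traces on the interfaces -/

open Classical in
/-- The elements of the `i`-th mesh whose visible part touches `x`. For almost every point of an
interface this is exactly one element on each side. -/
def touching {d k α N : ℕ} (D : Overlap d k α N) (i : Fin (N + 1)) (x : E d) :
    Finset (D.patch i).Idx :=
  Finset.univ.filter fun J => x ∈ closure ((D.patch i).elem J ∩ D.visible i)

/-- The trace at `x` of a function on `Ω i` that is continuous up to the boundary on the visible
part of each element: the limit at `x` from inside the touching element (the mean of these limits at
the exceptional points where several elements touch). -/
def trace {d k α N : ℕ} (D : Overlap d k α N) {G : Type*} [NormedAddCommGroup G] [NormedSpace ℝ G]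
    (i : Fin (N + 1)) (f : E d → G) (x : E d) : G :=
  ((D.touching i x).card : ℝ)⁻¹ •
    ∑ J ∈ D.touching i x, extendFrom ((D.patch i).elem J ∩ D.visible i) f x

/-- The trace at `x` of the mesh size function of the `i`-th mesh. -/
def meshSize {d k α N : ℕ} (D : Overlap d k α N) (i : Fin (N + 1)) (x : E d) : ℝ :=
  ((D.touching i x).card : ℝ)⁻¹ * ∑ J ∈ D.touching i x, D.size ⟨i, J⟩

/-- The mesh size function on the interface `Γ i j`. -/
def ifaceSize {d k α N : ℕ} (D : Overlap d k α N) (i j : Fin (N + 1)) (x : E d) : ℝ :=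
  D.meshSize (if D.lowerSize i j then j else i) x

/-- Squared weighted norm `‖h^{s/2} g‖²` in `L²(Γ i j)` with respect to the surface measure. -/
def ifaceSq {d k α N : ℕ} (D : Overlap d k α N) {G : Type*} [NormedAddCommGroup G]
    (s : ℤ) (i j : Fin (N + 1)) (g : E d → G) : ℝ≥0∞ :=
  ∫⁻ x in D.iface i j, ENNReal.ofReal (D.ifaceSize i j x ^ s) * ‖g x‖ₑ ^ 2 ∂μHE[d - 1]

/-! ### Norms and bilinear form -/

/-- `‖D v‖²` in `L²(Ω i)`, with the Frobenius norm of the matrix `D v`. -/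
def gradSq {d k α N : ℕ} (D : Overlap d k α N) (i : Fin (N + 1)) (v : E d → E d) : ℝ≥0∞ :=
  ∫⁻ x in D.visible i, ∑ l, ‖fderiv ℝ v x (e l)‖ₑ ^ 2

/-- `‖q‖²` in `L²(Ω i)`. -/
def presSq {d k α N : ℕ} (D : Overlap d k α N) (i : Fin (N + 1)) (q : E d → ℝ) : ℝ≥0∞ :=
  ∫⁻ x in D.visible i, ‖q x‖ₑ ^ 2

/-- The norm `‖v‖_{1,h}`. -/
def velNorm {d k α N : ℕ} (D : Overlap d k α N) (v : Fin (N + 1) → E d → E d) : ℝ≥0∞ :=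
  (∑ i, D.gradSq i (v i) + ∑ i, ∑ j ∈ Finset.Iio i,
    D.ifaceSq (-1) i j (fun x => D.trace i (v i) x - D.trace j (v j) x)) ^ (1 / 2 : ℝ)

/-- The norm `‖q‖_{0,h}`. -/
def presNorm {d k α N : ℕ} (D : Overlap d k α N) (q : Fin (N + 1) → E d → ℝ) : ℝ≥0∞ :=
  (∑ i, D.presSq i (q i) + ∑ i, ∑ j ∈ Finset.Iio i,
    D.ifaceSq 1 i j (fun x => D.trace i (q i) x - D.trace j (q j) x)) ^ (1 / 2 : ℝ)

/-- The local norm `‖v‖_{1,h,i}`. -/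
def localVelNorm {d k α N : ℕ} (D : Overlap d k α N) (i : Fin (N + 1)) (v : E d → E d) : ℝ≥0∞ :=
  (D.gradSq i v + ∑ l ∈ Finset.Ioi i, D.ifaceSq (-1) l i (D.trace i v) +
    ∑ j ∈ Finset.Iio i, D.ifaceSq (-1) i j (D.trace i v)) ^ (1 / 2 : ℝ)

/-- The bilinear form `b₀(v,q) = - ∑ᵢ ∫_{Ωᵢ} qᵢ div vᵢ`. -/
def bForm {d k α N : ℕ} (D : Overlap d k α N) (v : Fin (N + 1) → E d → E d)
    (q : Fin (N + 1) → E d → ℝ) : ℝ :=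
  -∑ i, ∫ x in D.visible i, q i x * divergence (v i) x

/-- The local discrete inf-sup condition with constant `β` on the `i`-th visible part. The supremum
runs over the velocities of nonzero norm. -/
def LocalInfSup {d k α N : ℕ} (D : Overlap d k α N) (t : ElementType) (θ : ℝ)
    (nb : D.Elem → D.Elem) (i : Fin (N + 1)) (β : ℝ) : Prop :=
  ∀ q ∈ D.stabPres t θ nb,
    ENNReal.ofReal β * (D.presSq i (q i)) ^ (1 / 2 : ℝ) ≤
      ⨆ v ∈ {v ∈ D.velSpace t i | D.localVelNorm i v ≠ 0},
        ENNReal.ofReal (∫ x in D.visible i, q i x * divergence v x) / D.localVelNorm i v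

end Overlap

end OverlapStokes

end

/-!
Local inf-sup conditions on overlapping patches imply a global one, because the velocity norm
decouples while the pressure jumps are harmless.

*Velocities.* On the `i`-th patch choose a velocity `v i` that tests `q i` up to `β / 2` and has the
same norm as `q i` (`LocalInfSup.exists_velocity`). The jump on an interface is the difference of
two traces, so the square of the broken norm of the tuple `v` is at most twice the sum of the
squared local norms (`velNorm_le`), and `bForm v q` dominates `∑ i, ‖q i‖²`. It remains to bound
`presNorm q` by the `L²` norms of the `q i`.

*Pressures.* The surface measure of an interface inside an element of size `h` is `O(h ^ (d - 1))`,
since the interface lies in a Lipschitz image of the boundary of the cube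
(`iface_part_measure_le`), and the weight there is `O(h)` (`ifaceSize_le`). Hence the claim follows
from a pointwise bound for a stabilized pressure on an element by `h ^ (-d / 2)` times its norm on
the visible part of a good element (`stabPres_sup_le`, `ifaceSq_jump_le`); finite overlap does the
rest (`sum_ifaceSq_jump_le`).

*Pointwise bound.* It is a Remez inequality: a polynomial of bounded degree in each variable is
controlled on a box by its mean square over any subset of positive density (`remez_tensorPoly`). In
one variable this is Lagrange interpolation at separated points, and Fubini gives the induction on
the dimension. On a good element it is applied to the pull-back of the pressure, whose Jacobian
factor is bounded above and below for a bi-Lipschitz parametrization; on a bad element it is applied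
to the projected polynomial, in a ball that contains both the element and its good neighbor.
-/

noncomputable section

namespace OverlapStokes

/-! ### Remez inequalities -/

/-- A set of large measure contains points that are far apart: greedily, the `δ`-neighborhoods of
at most `k` points cannot cover a set of measure at least `2δ(k+1)`. -/
theorem exists_separated_finset {S : Set ℝ} {δ : ℝ} (hδ : 0 < δ) (k : ℕ)
    (hS : ENNReal.ofReal ((k + 1) * (2 * δ)) ≤ volume S) (m : ℕ) (hm : m ≤ k + 1) :
    ∃ s : Finset ℝ, s.card = m ∧ (s : Set ℝ) ⊆ S ∧ ∀ x ∈ s, ∀ y ∈ s, x ≠ y → δ ≤ |x - y| := by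
  induction m with
  | zero => exact ⟨∅, by simp⟩
  | succ m ih =>
    obtain ⟨s, hc, hs, hsep⟩ := ih (by omega)
    have hlt : volume (⋃ x ∈ s, Ioo (x - δ) (x + δ)) < volume S := by
      calc volume (⋃ x ∈ s, Ioo (x - δ) (x + δ))
          ≤ ∑ x ∈ s, volume (Ioo (x - δ) (x + δ)) := measure_biUnion_finset_le _ _
        _ = ENNReal.ofReal (m * (2 * δ)) := by
          simp only [Real.volume_Ioo]
          rw [← ENNReal.ofReal_sum_of_nonneg (fun _ _ => by linarith)]
          simp only [add_sub_sub_cancel, Finset.sum_const, hc, nsmul_eq_mul]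
          ring_nf
        _ < ENNReal.ofReal ((k + 1) * (2 * δ)) := by
          have hmk : (m : ℝ) + 1 ≤ k + 1 := by exact_mod_cast hm
          rw [ENNReal.ofReal_lt_ofReal_iff (by positivity)]
          nlinarith
        _ ≤ volume S := hS
    obtain ⟨z, hz, hzn⟩ : ∃ z ∈ S, z ∉ ⋃ x ∈ s, Ioo (x - δ) (x + δ) := by
      by_contra! h
      exact absurd (measure_mono h) (not_le.2 hlt)
    simp only [mem_iUnion, mem_Ioo, not_exists, not_and, not_lt] at hzn
    have hfar : ∀ x ∈ s, δ ≤ |z - x| := by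
      intro x hx
      rcases le_or_gt z (x - δ) with h | h
      · rw [abs_of_nonpos (by linarith)]; linarith
      · have := hzn x hx h
        rw [abs_of_nonneg (by linarith)]; linarith
    have hzs : z ∉ s := fun h => by
      have := hfar z h
      simp only [sub_self, abs_zero] at this
      linarith
    refine ⟨insert z s, by rw [Finset.card_insert_of_notMem hzs, hc], ?_, ?_⟩
    · rw [Finset.coe_insert]
      exact insert_subset hz hs
    · intro x hx y hy hxy
      rcases Finset.mem_insert.1 hx with rfl | hx' <;> rcases Finset.mem_insert.1 hy with rfl | hy'
      · exact absurd rfl hxy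
      · exact hfar y hy'
      · rw [abs_sub_comm]; exact hfar x hx'
      · exact hsep x hx' y hy' hxy

/-- A Remez inequality on an interval: a polynomial is controlled by its values on a subset of
positive density, by Lagrange interpolation at well separated points of the subset. -/
theorem remez_interval {k : ℕ} {ϑ a b lam : ℝ} (hϑ : 0 < ϑ) (hab : a < b) {S : Set ℝ}
    (hSI : S ⊆ Icc a b) (hS : ENNReal.ofReal (ϑ * (b - a)) ≤ volume S) {p : ℝ[X]}
    (hp : p.natDegree ≤ k) (hlam : ∀ x ∈ S, |p.eval x| ≤ lam) {x : ℝ} (hx : x ∈ Icc a b) :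
    |p.eval x| ≤ (k + 1) * (2 * (k + 1) / ϑ) ^ k * lam := by
  have hba : 0 < b - a := by linarith
  set δ := ϑ * (b - a) / (2 * (k + 1)) with hδ
  have hδ0 : 0 < δ := by positivity
  obtain ⟨s, hc, hsS, hsep⟩ := exists_separated_finset (S := S) hδ0 k
    (by
      convert hS using 2
      rw [hδ]; field_simp) (k + 1) le_rfl
  have hdeg : p.degree < s.card := by
    rw [hc]
    exact lt_of_le_of_lt Polynomial.degree_le_natDegree (by exact_mod_cast Nat.lt_succ_of_le hp)
  have hinterp := Lagrange.eq_interpolate (v := id) Function.injective_id.injOn hdeg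
  have hbasis : ∀ i ∈ s, |(Lagrange.basis s id i).eval x| ≤ (2 * (k + 1) / ϑ) ^ k := by
    intro i hi
    rw [Lagrange.basis, Polynomial.eval_prod, Finset.abs_prod]
    have hcard : (s.erase i).card = k := by rw [Finset.card_erase_of_mem hi, hc]; rfl
    calc ∏ j ∈ s.erase i, |(Lagrange.basisDivisor (id i) (id j)).eval x|
        ≤ ∏ j ∈ s.erase i, (2 * (k + 1) / ϑ) := by
          refine Finset.prod_le_prod (fun _ _ => abs_nonneg _) fun j hj => ?_
          obtain ⟨hji, hjs⟩ := Finset.mem_erase.1 hj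
          have hij : δ ≤ |i - j| := hsep i hi j hjs (Ne.symm hji)
          have hxj : |x - j| ≤ b - a := by
            have h1 := hSI (hsS hjs)
            rw [abs_le]; constructor <;> linarith [h1.1, h1.2, hx.1, hx.2]
          have : (2 * (k + 1) / ϑ) = δ⁻¹ * (b - a) := by rw [hδ]; field_simp
          rw [this]
          simp only [Lagrange.basisDivisor, id, Polynomial.eval_mul, Polynomial.eval_C,
            Polynomial.eval_sub, Polynomial.eval_X, abs_mul, abs_inv]
          gcongr
      _ = (2 * (k + 1) / ϑ) ^ k := by rw [Finset.prod_const, hcard]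
  have hlam0 : 0 ≤ lam := by
    obtain ⟨i, hi⟩ : s.Nonempty := Finset.card_pos.1 (by omega)
    exact (abs_nonneg _).trans (hlam i (hsS hi))
  rw [hinterp, Lagrange.interpolate_apply, Polynomial.eval_finsetSum]
  calc |∑ i ∈ s, (Polynomial.C (p.eval (id i)) * Lagrange.basis s id i).eval x|
      ≤ ∑ i ∈ s, |(Polynomial.C (p.eval (id i)) * Lagrange.basis s id i).eval x| :=
        Finset.abs_sum_le_sum_abs _ _
    _ ≤ ∑ i ∈ s, lam * (2 * (k + 1) / ϑ) ^ k := by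
        refine Finset.sum_le_sum fun i hi => ?_
        rw [Polynomial.eval_mul, Polynomial.eval_C, abs_mul]
        exact mul_le_mul (hlam i (hsS hi)) (hbasis i hi) (abs_nonneg _) hlam0
    _ = (k + 1) * (2 * (k + 1) / ϑ) ^ k * lam := by
        rw [Finset.sum_const, hc, nsmul_eq_mul]; push_cast; ring

/-- A function of several real variables that is a polynomial of degree at most `k` in each
variable when the others are frozen. -/
def IsSepPoly {d : ℕ} (k : ℕ) (f : (Fin d → ℝ) → ℝ) : Prop :=
  ∀ x l, ∃ p : ℝ[X], p.natDegree ≤ k ∧ ∀ t, f (Function.update x l t) = p.eval t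

/-- The measure of a set in a product is at most that of its large slices, plus a contribution of
the small slices. -/
theorem ofReal_le_volume_large_slices {d : ℕ} {ϑ V a b : ℝ} (hϑ : 0 < ϑ) (hV : 0 < V)
    (hab : a < b) {A : Set (ℝ × (Fin d → ℝ))} (hA : MeasurableSet A)
    (hAI : ∀ z ∈ A, z.1 ∈ Icc a b) (hAV : ∀ t, volume (Prod.mk t ⁻¹' A) ≤ ENNReal.ofReal V)
    (hvol : ENNReal.ofReal (ϑ * ((b - a) * V)) ≤ volume A) :
    ENNReal.ofReal (ϑ / 2 * (b - a)) ≤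
      volume {t ∈ Icc a b | ENNReal.ofReal (ϑ / 2 * V) ≤ volume (Prod.mk t ⁻¹' A)} := by
  have hba : 0 < b - a := by linarith
  set g : ℝ → ℝ≥0∞ := fun t => volume (Prod.mk t ⁻¹' A) with hg
  have hgm : Measurable g := measurable_measure_prodMk_left hA
  set T := {t ∈ Icc a b | ENNReal.ofReal (ϑ / 2 * V) ≤ g t} with hT
  have hTm : MeasurableSet T := measurableSet_Icc.inter (measurableSet_le measurable_const hgm)
  have hle : ∀ t, g t ≤ T.indicator (fun _ => ENNReal.ofReal V) t +
      (Icc a b).indicator (fun _ => ENNReal.ofReal (ϑ / 2 * V)) t := by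
    intro t
    by_cases htI : t ∈ Icc a b
    · by_cases htT : t ∈ T
      · rw [indicator_of_mem htT]
        exact (hAV t).trans le_self_add
      · rw [indicator_of_mem htI]
        have : ¬ ENNReal.ofReal (ϑ / 2 * V) ≤ g t := fun h => htT ⟨htI, h⟩
        exact (not_le.1 this).le.trans le_add_self
    · have : Prod.mk t ⁻¹' A = ∅ := by
        ext y; simp only [mem_preimage, mem_empty_iff_false, iff_false]
        exact fun h => htI (hAI _ h)
      simp [hg, this]
  have hsum : volume A ≤ ENNReal.ofReal V * volume T +
      ENNReal.ofReal (ϑ / 2 * V) * ENNReal.ofReal (b - a) := by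
    rw [Measure.volume_eq_prod, Measure.prod_apply hA]
    refine (lintegral_mono hle).trans ?_
    rw [lintegral_add_left (measurable_const.indicator hTm), lintegral_indicator_const hTm,
      lintegral_indicator_const measurableSet_Icc, Real.volume_Icc]
  have hTfin : volume T ≠ ⊤ :=
    ((measure_mono (fun t ht => ht.1)).trans_lt (by rw [Real.volume_Icc]; simp :
      volume (Icc a b) < ⊤)).ne
  have := hvol.trans hsum
  rw [← ENNReal.ofReal_toReal hTfin, ← ENNReal.ofReal_mul hV.le, ← ENNReal.ofReal_mul (by positivity),
    ← ENNReal.ofReal_add (by positivity) (by positivity),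
    ENNReal.ofReal_le_ofReal_iff (by positivity)] at this
  rw [← ENNReal.ofReal_toReal hTfin]
  refine ENNReal.ofReal_le_ofReal ?_
  have h2 : V * (ϑ / 2 * (b - a)) ≤ V * (volume T).toReal := by nlinarith
  exact le_of_mul_le_mul_left h2 hV

/-- A Remez inequality on a box: a function that is a polynomial of bounded degree in each variable
is controlled, on the whole box, by its values on a subset of positive density. By induction on the
dimension, through the slices in which the subset keeps a positive density. -/
theorem remez_box (k d : ℕ) {ϑ : ℝ} (hϑ : 0 < ϑ) : ∃ M : ℝ, 0 ≤ M ∧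
    ∀ (a b : Fin d → ℝ), (∀ l, a l < b l) → ∀ f : (Fin d → ℝ) → ℝ, Measurable f →
      IsSepPoly k f → ∀ lam : ℝ,
      ENNReal.ofReal (ϑ * ∏ l, (b l - a l)) ≤ volume {x ∈ Icc a b | |f x| ≤ lam} →
      ∀ x ∈ Icc a b, |f x| ≤ M * lam := by
  induction d generalizing ϑ with
  | zero =>
    refine ⟨1, zero_le_one, fun a b _ f _ _ lam h x _ => ?_⟩
    rw [Finset.univ_eq_empty, Finset.prod_empty, mul_one] at h
    obtain ⟨y, hy⟩ : {x ∈ Icc a b | |f x| ≤ lam}.Nonempty := by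
      by_contra hne
      rw [not_nonempty_iff_eq_empty] at hne
      rw [hne, measure_empty] at h
      exact absurd h (not_le.2 (by simpa using hϑ))
    rw [Subsingleton.elim x y, one_mul]
    exact hy.2
  | succ d ih =>
    obtain ⟨M, hM, hMb⟩ := ih (ϑ := ϑ / 2) (by positivity)
    refine ⟨(k + 1) * (2 * (k + 1) / (ϑ / 2)) ^ k * M, by positivity,
      fun a b hab f hf hsep lam h x hx => ?_⟩
    set V := ∏ l : Fin d, (b l.succ - a l.succ) with hV
    have hVpos : 0 < V := Finset.prod_pos fun l _ => sub_pos.2 (hab _)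
    set S := {x ∈ Icc a b | |f x| ≤ lam} with hS
    have hSm : MeasurableSet S :=
      measurableSet_Icc.inter (measurableSet_le (measurable_norm.comp hf) measurable_const)
    have hmp := (volume_preserving_piFinSuccAbove (fun _ : Fin (d + 1) => ℝ) 0).symm
    set A : Set (ℝ × (Fin d → ℝ)) :=
      (MeasurableEquiv.piFinSuccAbove (fun _ : Fin (d + 1) => ℝ) 0).symm ⁻¹' S with hA
    have hAm : MeasurableSet A := hmp.measurable hSm
    have hAvol : volume A = volume S := hmp.measure_preimage hSm.nullMeasurableSet
    have hcons : ∀ t y, (t, y) ∈ A ↔ (Fin.cons t y : Fin (d + 1) → ℝ) ∈ S := by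
      intro t y
      simp [hA, MeasurableEquiv.piFinSuccAbove, Fin.insertNthEquiv]
    have hbox : ∀ t y, (Fin.cons t y : Fin (d + 1) → ℝ) ∈ Icc a b ↔
        t ∈ Icc (a 0) (b 0) ∧ y ∈ Icc (fun l => a (Fin.succ l)) (fun l => b (Fin.succ l)) := by
      intro t y
      simp only [mem_Icc, Pi.le_def, Fin.forall_fin_succ, Fin.cons_zero, Fin.cons_succ]
      tauto
    have hslice : ∀ t, Prod.mk t ⁻¹' A ⊆
        {y ∈ Icc (fun l => a (Fin.succ l)) (fun l => b (Fin.succ l)) |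
          |f (Fin.cons t y : Fin (d + 1) → ℝ)| ≤ lam} := fun t y hy =>
      ⟨((hbox t y).1 ((hcons t y).1 hy).1).2, ((hcons t y).1 hy).2⟩
    have hlarge := ofReal_le_volume_large_slices (A := A) hϑ hVpos (hab 0) hAm
      (fun z hz => ((hbox z.1 z.2).1 ((hcons z.1 z.2).1 hz).1).1)
      (fun t => by
        refine (measure_mono ((hslice t).trans (sep_subset _ _))).trans ?_
        rw [Real.volume_Icc_pi, ← ENNReal.ofReal_prod_of_nonneg
          (fun l _ => (sub_pos.2 (hab _)).le)])
      (by rw [hAvol]; rwa [Fin.prod_univ_succ] at h)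
    obtain ⟨t₀, y, rfl⟩ : ∃ t y, x = (Fin.cons t y : Fin (d + 1) → ℝ) :=
      ⟨x 0, Fin.tail x, (Fin.cons_self_tail x).symm⟩
    obtain ⟨ht₀, hy⟩ := (hbox t₀ y).1 hx
    obtain ⟨p, hp, hpf⟩ := hsep (Fin.cons t₀ y) 0
    simp only [Fin.update_cons_zero] at hpf
    rw [hpf, mul_assoc]
    refine remez_interval (by positivity) (hab 0) (sep_subset _ _) hlarge hp ?_ ht₀
    rintro t ⟨-, ht⟩
    rw [← hpf]
    refine hMb _ _ (fun l => hab _) (fun y => f (Fin.cons t y : Fin (d + 1) → ℝ)) ?_ ?_ lam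
      (ht.trans (measure_mono (hslice t))) y hy
    · refine hf.comp (measurable_pi_lambda _ fun l => ?_)
      refine Fin.cases ?_ (fun l => ?_) l
      · simp
      · simpa using measurable_pi_apply l
    · intro z l
      obtain ⟨p, hp, hpf⟩ := hsep (Fin.cons t z) l.succ
      exact ⟨p, hp, fun s => by rw [← hpf s, ← Fin.cons_update]⟩

/-- The `L²` form of the Remez inequality on a box. -/
theorem remez_box_sq (k d : ℕ) {ϑ : ℝ} (hϑ : 0 < ϑ) : ∃ M : ℝ≥0,
    ∀ (a b : Fin d → ℝ), (∀ l, a l < b l) → ∀ f : (Fin d → ℝ) → ℝ, Measurable f →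
      IsSepPoly k f → ∀ S ⊆ Icc a b, MeasurableSet S →
      ENNReal.ofReal (ϑ * ∏ l, (b l - a l)) ≤ volume S →
      ∀ x ∈ Icc a b, ‖f x‖ₑ ^ 2 * volume S ≤ M * ∫⁻ y in S, ‖f y‖ₑ ^ 2 := by
  obtain ⟨M, hM, hMb⟩ := remez_box k d (ϑ := ϑ / 2) (by positivity)
  refine ⟨(2 * (M + 1) ^ 2).toNNReal, fun a b hab f hf hsep S hSQ hSm hvol x hx => ?_⟩
  by_cases hfx : f x = 0
  · simp [hfx]
  have hV : 0 < ∏ l, (b l - a l) := Finset.prod_pos fun l _ => sub_pos.2 (hab l)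
  have hSfin : volume S ≠ ⊤ := (measure_mono hSQ |>.trans_lt
    (by rw [Real.volume_Icc_pi]; exact ENNReal.prod_lt_top (by simp))).ne
  have hSpos : ϑ * ∏ l, (b l - a l) ≤ (volume S).toReal := by
    rwa [← ENNReal.ofReal_le_iff_le_toReal hSfin]
  have hfx0 : 0 < |f x| := abs_pos.2 hfx
  -- At this level the sup bound fails, so `|f|` exceeds it on at least half of `S`.
  set lam := |f x| / (M + 1) with hlam
  have hlam0 : 0 < lam := by positivity
  have hlt : volume {y ∈ Icc a b | |f y| ≤ lam} <
      ENNReal.ofReal (ϑ / 2 * ∏ l, (b l - a l)) := by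
    by_contra h
    have h1 := hMb a b hab f hf hsep lam (not_lt.1 h) x hx
    have h2 : |f x| = (M + 1) * lam := by rw [hlam]; field_simp
    nlinarith
  set B := {y ∈ S | lam < |f y|} with hB
  have hBm : MeasurableSet B :=
    hSm.inter (measurableSet_lt measurable_const (measurable_norm.comp hf))
  have hSB : volume S ≤ ENNReal.ofReal (ϑ / 2 * ∏ l, (b l - a l)) + volume B := by
    refine (measure_mono (?_ : S ⊆ {y ∈ Icc a b | |f y| ≤ lam} ∪ B)).trans
      ((measure_union_le _ _).trans (by gcongr))
    intro y hy
    rcases le_or_gt |f y| lam with h | h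
    · exact Or.inl ⟨hSQ hy, h⟩
    · exact Or.inr ⟨hy, h⟩
  have hBfin : volume B ≠ ⊤ := ((measure_mono (sep_subset _ _)).trans_lt hSfin.lt_top).ne
  have hSB' : (volume S).toReal ≤ 2 * (volume B).toReal := by
    rw [← ENNReal.ofReal_toReal hSfin, ← ENNReal.ofReal_toReal hBfin,
      ← ENNReal.ofReal_add (by positivity) (by positivity),
      ENNReal.ofReal_le_ofReal_iff (by positivity)] at hSB
    linarith
  have hint : ENNReal.ofReal (lam ^ 2) * volume B ≤ ∫⁻ y in S, ‖f y‖ₑ ^ 2 := by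
    rw [← setLIntegral_const]
    refine (setLIntegral_mono' hBm fun y hy => ?_).trans
      (lintegral_mono_set (sep_subset _ _))
    rw [← ofReal_norm, ← ENNReal.ofReal_pow (norm_nonneg _)]
    exact ENNReal.ofReal_le_ofReal (pow_le_pow_left₀ hlam0.le hy.2.le 2)
  refine le_trans ?_ (mul_le_mul_right hint _)
  rw [← ofReal_norm, ← ENNReal.ofReal_pow (norm_nonneg _), ← ENNReal.ofReal_toReal hSfin,
    ← ENNReal.ofReal_toReal hBfin, ← ENNReal.ofReal_mul (by positivity),
    ← ENNReal.ofReal_mul (by positivity)]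
  change _ ≤ ENNReal.ofReal (2 * (M + 1) ^ 2) * _
  rw [← ENNReal.ofReal_mul (by positivity)]
  refine ENNReal.ofReal_le_ofReal ?_
  have h2 : ‖f x‖ = (M + 1) * lam := by rw [hlam, Real.norm_eq_abs]; field_simp
  rw [h2]
  nlinarith [mul_le_mul_of_nonneg_left hSB' (by positivity : 0 ≤ ((M + 1) * lam) ^ 2)]

/-! ### Tensor product polynomials -/

/-- The tensor product polynomials of degree at most `k` in each variable, as the span of the
products of univariate polynomials. -/
def tensorPoly (d k : ℕ) : Submodule ℝ (E d → ℝ) :=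
  Submodule.span ℝ {f | ∃ p : Fin d → ℝ[X], (∀ l, (p l).natDegree ≤ k) ∧
    ∀ ξ, f ξ = ∏ l, (p l).eval (ξ l)}

theorem contDiff_of_mem_tensorPoly {d k : ℕ} {f : E d → ℝ} (hf : f ∈ tensorPoly d k)
    (n : WithTop ℕ∞) : ContDiff ℝ n f := by
  induction hf using Submodule.span_induction with
  | mem f hf =>
    obtain ⟨p, -, hp⟩ := hf
    rw [funext hp]
    refine contDiff_prod fun l _ => ?_
    have h : ContDiff ℝ n (fun t : ℝ => (p l).eval t) := by
      simpa only [Polynomial.coe_aeval_eq_eval] using (p l).contDiff_aeval (𝕜 := ℝ) n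
    exact h.comp (contDiff_piLp_apply (p := 2) (i := l))
  | zero => exact contDiff_const
  | add f g _ _ hf hg => exact hf.add hg
  | smul c f _ hf => exact contDiff_const.smul hf

theorem isSepPoly_of_mem_tensorPoly {d k : ℕ} {f : E d → ℝ} (hf : f ∈ tensorPoly d k) :
    IsSepPoly k (fun x => f (WithLp.toLp 2 x)) := by
  intro x l
  induction hf using Submodule.span_induction with
  | mem f hf =>
    obtain ⟨p, hpk, hp⟩ := hf
    refine ⟨Polynomial.C (∏ i ∈ Finset.univ.erase l, (p i).eval (x i)) * p l,
      (Polynomial.natDegree_C_mul_le _ _).trans (hpk l), fun t => ?_⟩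
    refine (hp _).trans ?_
    rw [Polynomial.eval_mul, Polynomial.eval_C,
      ← Finset.mul_prod_erase _ _ (Finset.mem_univ l), mul_comm]
    congr 1
    · exact Finset.prod_congr rfl fun i hi => by simp [Finset.ne_of_mem_erase hi]
    · simp
  | zero => exact ⟨0, by simp⟩
  | add f g _ _ hf hg =>
    obtain ⟨p, hp, hpf⟩ := hf
    obtain ⟨q, hq, hqf⟩ := hg
    exact ⟨p + q, (Polynomial.natDegree_add_le _ _).trans (max_le hp hq), fun t => by
      rw [Polynomial.eval_add, ← hpf, ← hqf]; rfl⟩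
  | smul c f _ hf =>
    obtain ⟨p, hp, hpf⟩ := hf
    exact ⟨c • p, (Polynomial.natDegree_smul_le _ _).trans hp, fun t => by
      rw [Polynomial.eval_smul, ← hpf]; rfl⟩

theorem IsTensorPoly.mem_tensorPoly {d k : ℕ} {r : E d → ℝ} (hr : IsTensorPoly k r) :
    r ∈ tensorPoly d k := by
  obtain ⟨p, hp, hpr⟩ := hr
  have : r = ∑ m ∈ p.support, p.coeff m • fun x : E d => ∏ i, x i ^ m i := by
    funext x
    rw [hpr, MvPolynomial.eval_eq', Finset.sum_apply]
    rfl
  rw [this]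
  refine Submodule.sum_mem _ fun m hm => Submodule.smul_mem _ _ (Submodule.subset_span
    ⟨fun l => Polynomial.X ^ m l, fun l => ?_, fun ξ => by simp⟩)
  rw [Polynomial.natDegree_X_pow]
  exact MvPolynomial.degreeOf_le_iff.1 (hp l) m hm

/-- A tensor product spline coincides on each closed element with a tensor product polynomial. -/
theorem exists_tensorPoly_of_mem_splineSpace {d K : ℕ} {n : Fin d → ℕ}
    {ζ : ∀ l, Fin (n l + 1) → ℝ} {k r : Fin d → ℕ} (hk : ∀ l, k l ≤ K) {f : E d → ℝ}
    (hf : f ∈ splineSpace ζ k r) (J : ∀ l, Fin (n l)) :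
    ∃ p ∈ tensorPoly d K,
      EqOn f p {ξ | ∀ l, ξ l ∈ Icc (ζ l (J l).castSucc) (ζ l (J l).succ)} := by
  induction hf using Submodule.span_induction with
  | mem f hf =>
    obtain ⟨s, hs, hfs⟩ := hf
    choose p hp hps using fun l => (hs l).2 (J l)
    refine ⟨fun ξ => ∏ l, (p l).eval (ξ l),
      Submodule.subset_span ⟨p, fun l => (hp l).trans (hk l), fun ξ => rfl⟩, fun ξ hξ => ?_⟩
    rw [hfs]
    exact Finset.prod_congr rfl fun l _ => hps l (hξ l)
  | zero => exact ⟨0, Submodule.zero_mem _, fun _ _ => rfl⟩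
  | add f g _ _ hf hg =>
    obtain ⟨p, hp, hpf⟩ := hf
    obtain ⟨q, hq, hqg⟩ := hg
    exact ⟨p + q, Submodule.add_mem _ hp hq, fun ξ hξ => by
      simp only [Pi.add_apply, hpf hξ, hqg hξ]⟩
  | smul c f _ hf =>
    obtain ⟨p, hp, hpf⟩ := hf
    exact ⟨c • p, Submodule.smul_mem _ _ hp, fun ξ hξ => by
      simp only [Pi.smul_apply, hpf hξ]⟩

/-! ### Boxes in Euclidean space -/

/-- The closed box with lower corner `a` and upper corner `b`. -/
def closedBox {d : ℕ} (a b : Fin d → ℝ) : Set (E d) := {ξ | ∀ l, ξ l ∈ Icc (a l) (b l)}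

/-- The open box with lower corner `a` and upper corner `b`. -/
def openBox {d : ℕ} (a b : Fin d → ℝ) : Set (E d) := {ξ | ∀ l, ξ l ∈ Ioo (a l) (b l)}

theorem openBox_subset_closedBox {d : ℕ} (a b : Fin d → ℝ) : openBox a b ⊆ closedBox a b :=
  fun _ h l => Ioo_subset_Icc_self (h l)

theorem closedBox_eq_preimage {d : ℕ} (a b : Fin d → ℝ) :
    closedBox a b = EuclideanSpace.equiv (Fin d) ℝ ⁻¹' Icc a b := by
  ext ξ
  simp [closedBox, Pi.le_def, forall_and]

theorem openBox_eq_preimage {d : ℕ} (a b : Fin d → ℝ) :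
    openBox a b = EuclideanSpace.equiv (Fin d) ℝ ⁻¹' (univ.pi fun l => Ioo (a l) (b l)) := by
  ext ξ
  simp [openBox]

theorem isCompact_closedBox {d : ℕ} (a b : Fin d → ℝ) : IsCompact (closedBox a b) := by
  rw [closedBox_eq_preimage]
  exact (EuclideanSpace.equiv (Fin d) ℝ).toHomeomorph.isCompact_preimage.2 isCompact_Icc

theorem isOpen_openBox {d : ℕ} (a b : Fin d → ℝ) : IsOpen (openBox a b) := by
  rw [openBox_eq_preimage]
  exact (isOpen_set_pi finite_univ fun l _ => isOpen_Ioo).preimage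
    (EuclideanSpace.equiv (Fin d) ℝ).continuous

theorem closure_openBox {d : ℕ} {a b : Fin d → ℝ} (hab : ∀ l, a l < b l) :
    closure (openBox a b) = closedBox a b := by
  rw [openBox_eq_preimage, closedBox_eq_preimage]
  refine ((EuclideanSpace.equiv (Fin d) ℝ).toHomeomorph.preimage_closure _).symm.trans ?_
  rw [closure_pi_set]
  simp only [closure_Ioo (hab _).ne]
  rw [← pi_univ_Icc]
  rfl

theorem volume_openBox {d : ℕ} {a b : Fin d → ℝ} (hab : ∀ l, a l < b l) :
    volume (openBox a b) = ENNReal.ofReal (∏ l, (b l - a l)) := by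
  rw [openBox_eq_preimage]
  refine ((PiLp.volume_preserving_ofLp (Fin d)).measure_preimage
    (MeasurableSet.univ_pi fun _ => measurableSet_Ioo).nullMeasurableSet).trans ?_
  rw [Real.volume_pi_Ioo, ENNReal.ofReal_prod_of_nonneg fun l _ => (sub_pos.2 (hab l)).le]

/-- The `L²` Remez inequality for tensor product polynomials on a box of Euclidean space. -/
theorem remez_tensorPoly (k d : ℕ) {ϑ : ℝ} (hϑ : 0 < ϑ) : ∃ M : ℝ≥0,
    ∀ (a b : Fin d → ℝ), (∀ l, a l < b l) → ∀ f ∈ tensorPoly d k,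
      ∀ S ⊆ closedBox a b, MeasurableSet S →
      ENNReal.ofReal (ϑ * ∏ l, (b l - a l)) ≤ volume S →
      ∀ x ∈ closedBox a b, ‖f x‖ₑ ^ 2 * volume S ≤ M * ∫⁻ y in S, ‖f y‖ₑ ^ 2 := by
  obtain ⟨M, hM⟩ := remez_box_sq k d hϑ
  refine ⟨M, fun a b hab f hf S hS hSm hvol x hx => ?_⟩
  have hmp := PiLp.volume_preserving_toLp (Fin d)
  have hpre : volume (WithLp.toLp 2 ⁻¹' S : Set (Fin d → ℝ)) = volume S :=
    hmp.measure_preimage hSm.nullMeasurableSet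
  have hcont : Continuous f := (contDiff_of_mem_tensorPoly hf 0).continuous
  have := hM a b hab (fun x => f (WithLp.toLp 2 x))
    (hcont.measurable.comp hmp.measurable) (isSepPoly_of_mem_tensorPoly hf)
    (WithLp.toLp 2 ⁻¹' S) (fun y hy => by
      have h1 : (WithLp.toLp 2 y : E d) ∈ closedBox a b := hS hy
      rwa [closedBox_eq_preimage] at h1) (hmp.measurable hSm) (by rwa [hpre])
    (WithLp.ofLp x) (by rwa [closedBox_eq_preimage] at hx)
  rw [hpre] at this
  refine this.trans_eq ?_
  congr 1
  exact hmp.setLIntegral_comp_preimage hSm (f := fun y => ‖f y‖ₑ ^ 2)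
    (hcont.measurable.enorm.pow_const 2)

/-! ### Measures of Lipschitz images -/

theorem euclideanHausdorffMeasure_image_le {X Y : Type*} [EMetricSpace X] [EMetricSpace Y]
    [MeasurableSpace X] [BorelSpace X] [MeasurableSpace Y] [BorelSpace Y] {K : ℝ≥0} {f : X → Y}
    {s : Set X} (h : LipschitzOnWith K f s) (n : ℕ) :
    (μHE[n] : Measure Y) (f '' s) ≤ K ^ n * (μHE[n] : Measure X) s := by
  have := h.hausdorffMeasure_image_le (d := n) n.cast_nonneg
  rw [ENNReal.rpow_natCast] at this
  simp only [Measure.euclideanHausdorffMeasure_def, Measure.smul_apply, ENNReal.smul_def,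
    smul_eq_mul]
  calc _ ≤ _ := mul_le_mul_right this _
    _ = _ := by ring

theorem volume_image_le {d : ℕ} {K : ℝ≥0} {f : E d → E d} {s : Set (E d)}
    (h : LipschitzOnWith K f s) : volume (f '' s) ≤ K ^ d * volume s := by
  have := euclideanHausdorffMeasure_image_le h d
  rwa [EuclideanSpace.euclideanHausdorffMeasure_eq_volume] at this

theorem volume_le_image {d : ℕ} {K : ℝ≥0} {f : E d → E d} {s : Set (E d)}
    (h : ∀ x ∈ s, ∀ y ∈ s, dist x y ≤ K * dist (f x) (f y)) :
    volume s ≤ K ^ d * volume (f '' s) := by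
  have hinj : InjOn f s := fun x hx y hy hxy => by
    have := h x hx y hy
    rw [hxy, dist_self, mul_zero] at this
    exact dist_le_zero.1 this
  have hl : LipschitzOnWith K (Function.invFunOn f s) (f '' s) := by
    refine LipschitzOnWith.of_dist_le_mul ?_
    rintro _ ⟨x, hx, rfl⟩ _ ⟨y, hy, rfl⟩
    rw [hinj.leftInvOn_invFunOn hx, hinj.leftInvOn_invFunOn hy]
    exact h x hx y hy
  have := volume_image_le hl
  rwa [hinj.leftInvOn_invFunOn.image_image] at this

/-- The determinant of a bi-Lipschitz linear map is bounded above and below. -/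
theorem abs_det_bounds {d : ℕ} {K : ℝ≥0} {A : E d →L[ℝ] E d} (h1 : ∀ v, ‖A v‖ ≤ K * ‖v‖)
    (h2 : ∀ v, ‖v‖ ≤ K * ‖A v‖) : |A.det| ≤ K ^ d ∧ 1 ≤ K ^ d * |A.det| := by
  set B : Set (E d) := Metric.ball 0 1
  have hB0 : volume B ≠ 0 := (Metric.measure_ball_pos _ _ one_pos).ne'
  have hBt : volume B ≠ ⊤ := measure_ball_lt_top.ne
  have himg : volume (A '' B) = ENNReal.ofReal |A.det| * volume B :=
    Measure.addHaar_image_continuousLinearMap _ _ _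
  have hK : (K : ℝ≥0∞) ^ d = ENNReal.ofReal ((K : ℝ) ^ d) := by
    rw [ENNReal.ofReal_pow K.coe_nonneg, ENNReal.ofReal_coe_nnreal]
  constructor
  · have := volume_image_le (K := K) (f := A) (s := B)
      (LipschitzOnWith.of_dist_le_mul fun x _ y _ => by
        rw [dist_eq_norm, dist_eq_norm, ← map_sub]; exact h1 _)
    rw [himg, ENNReal.mul_le_mul_iff_left hB0 hBt, hK] at this
    exact (ENNReal.ofReal_le_ofReal_iff (by positivity)).1 this
  · have := volume_le_image (K := K) (f := A) (s := B) fun x _ y _ => by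
        rw [dist_eq_norm, dist_eq_norm, ← map_sub]; exact h2 _
    rw [himg, ← mul_assoc, hK, ← ENNReal.ofReal_mul (by positivity)] at this
    nth_rw 1 [← one_mul (volume B)] at this
    rw [ENNReal.mul_le_mul_iff_left hB0 hBt] at this
    exact ENNReal.one_le_ofReal.1 this

/-- The derivative of a locally bi-Lipschitz map is bi-Lipschitz. -/
theorem fderiv_bounds {d : ℕ} {K : ℝ≥0} {f : E d → E d} {x : E d} {U : Set (E d)} (hU : U ∈ 𝓝 x)
    (hf : DifferentiableAt ℝ f x)
    (h : ∀ y ∈ U, dist (f y) (f x) ≤ K * dist y x ∧ dist y x ≤ K * dist (f y) (f x)) (v : E d) :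
    ‖fderiv ℝ f x v‖ ≤ K * ‖v‖ ∧ ‖v‖ ≤ K * ‖fderiv ℝ f x v‖ := by
  have hlim := (hf.hasFDerivAt.hasLineDerivAt v).tendsto_slope_zero.norm
  have hev : ∀ᶠ t : ℝ in 𝓝[≠] 0, x + t • v ∈ U := by
    have : Tendsto (fun t : ℝ => x + t • v) (𝓝 0) (𝓝 x) := by
      have hc : Continuous fun t : ℝ => x + t • v := by fun_prop
      simpa using hc.tendsto 0
    exact (this.eventually hU).filter_mono nhdsWithin_le_nhds
  constructor
  · refine le_of_tendsto hlim ?_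
    filter_upwards [hev, self_mem_nhdsWithin] with t ht ht0
    have h0 : 0 < |t| := abs_pos.2 ht0
    have := (h _ ht).1
    rw [dist_eq_norm, dist_eq_norm, add_sub_cancel_left, norm_smul, Real.norm_eq_abs] at this
    rw [norm_smul, norm_inv, Real.norm_eq_abs, inv_mul_le_iff₀ h0]
    linarith
  · refine ge_of_tendsto (hlim.const_mul (K : ℝ)) ?_
    filter_upwards [hev, self_mem_nhdsWithin] with t ht ht0
    have h0 : 0 < |t| := abs_pos.2 ht0
    have := (h _ ht).2
    rw [dist_eq_norm, dist_eq_norm, add_sub_cancel_left, norm_smul, Real.norm_eq_abs] at this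
    rw [norm_smul, norm_inv, Real.norm_eq_abs, mul_left_comm, le_inv_mul_iff₀ h0]
    exact this

/-- The surface measure of a subset of a coordinate hyperplane is controlled by its radius. -/
theorem hyperplane_measure_le (n : ℕ) : ∃ C : ℝ≥0, ∀ (l : Fin (n + 1)) (s : ℝ) (T : Set (E (n + 1)))
    (x₀ : E (n + 1)) (ρ : ℝ), 0 ≤ ρ → (∀ ξ ∈ T, ξ l = s) → T ⊆ Metric.closedBall x₀ ρ →
    (μHE[n] : Measure (E (n + 1))) T ≤ C * ENNReal.ofReal ρ ^ n := by
  obtain ⟨K, hK⟩ : ∃ K : ℝ≥0, LipschitzWith K (WithLp.toLp 2 : (Fin (n + 1) → ℝ) → E (n + 1)) :=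
    ⟨_, PiLp.lipschitzWith_toLp 2 (fun _ : Fin (n + 1) => ℝ)⟩
  set cH := Measure.addHaarScalarFactor (volume : Measure (EuclideanSpace ℝ (Fin n))) μH[n]
  refine ⟨K ^ n * cH * 2 ^ n, fun l s T x₀ ρ hρ hT hball => ?_⟩
  set ι : (Fin n → ℝ) → E (n + 1) := fun y => WithLp.toLp 2 (l.insertNth s y)
  have hι : LipschitzWith K ι := by
    have : LipschitzWith 1 fun y : Fin n → ℝ => (l.insertNth s y : Fin (n + 1) → ℝ) := by
      refine LipschitzWith.of_dist_le_mul fun x y => ?_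
      rw [NNReal.coe_one, one_mul, dist_pi_le_iff dist_nonneg]
      intro i
      refine Fin.succAboveCases l ?_ (fun j => ?_) i
      · simp
      · simpa using dist_le_pi_dist x y j
    have h := hK.comp this
    rwa [mul_one] at h
  set B : Set (Fin n → ℝ) := Metric.closedBall (fun j => x₀ (l.succAbove j)) ρ
  have hTB : T ⊆ ι '' B := by
    intro ξ hξ
    refine ⟨fun j => ξ (l.succAbove j), ?_, ?_⟩
    · rw [Metric.mem_closedBall, dist_pi_le_iff hρ]
      intro j
      have h1 : dist ξ x₀ ≤ ρ := hball hξ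
      rw [dist_eq_norm] at h1
      have h2 := PiLp.norm_apply_le (ξ - x₀) (l.succAbove j)
      rw [Real.dist_eq]
      exact h2.trans h1
    · ext i
      refine Fin.succAboveCases l ?_ (fun j => ?_) i
      · simp [ι, hT ξ hξ]
      · simp [ι]
  refine (measure_mono hTB).trans ((euclideanHausdorffMeasure_image_le hι.lipschitzOnWith n).trans ?_)
  have hvol : (μH[n] : Measure (Fin n → ℝ)) B = ENNReal.ofReal (2 * ρ) ^ n := by
    have h := hausdorffMeasure_pi_real (ι := Fin n)
    rw [Fintype.card_fin] at h
    rw [h, Real.volume_pi_closedBall _ hρ, Fintype.card_fin, ENNReal.ofReal_pow (by positivity)]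
  rw [Measure.euclideanHausdorffMeasure_def, Measure.smul_apply, hvol, ENNReal.smul_def,
    smul_eq_mul, ENNReal.ofReal_mul zero_le_two, mul_pow, ENNReal.ofReal_ofNat]
  push_cast
  exact le_of_eq (by ring)

/-- The surface measure of a subset of the boundary of the unit cube is controlled by its radius. -/
theorem cube_boundary_measure_le (n : ℕ) : ∃ C : ℝ≥0, ∀ (T : Set (E (n + 1))) (x₀ : E (n + 1))
    (ρ : ℝ), 0 ≤ ρ → T ⊆ closedCube (n + 1) \ openCube (n + 1) → T ⊆ Metric.closedBall x₀ ρ →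
    (μHE[n] : Measure (E (n + 1))) T ≤ C * ENNReal.ofReal ρ ^ n := by
  obtain ⟨C, hC⟩ := hyperplane_measure_le n
  refine ⟨2 * (n + 1) * C, fun T x₀ ρ hρ hT hball => ?_⟩
  have hsub : T ⊆ ⋃ l : Fin (n + 1), (T ∩ {ξ | ξ l = 0}) ∪ (T ∩ {ξ | ξ l = 1}) := by
    intro ξ hξ
    obtain ⟨hcl, hop⟩ := hT hξ
    simp only [openCube, mem_ofPred_eq, not_forall] at hop
    obtain ⟨l, hl⟩ := hop
    have h01 := hcl l
    simp only [mem_Ioo, not_and_or, not_lt] at hl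
    refine mem_iUnion.2 ⟨l, ?_⟩
    rcases hl with h | h
    · exact Or.inl ⟨hξ, le_antisymm h h01.1⟩
    · exact Or.inr ⟨hξ, le_antisymm h01.2 h⟩
  have hpart : ∀ (l : Fin (n + 1)) (s : ℝ),
      (μHE[n] : Measure (E (n + 1))) (T ∩ {ξ | ξ l = s}) ≤ C * ENNReal.ofReal ρ ^ n := fun l s =>
    hC l s _ x₀ ρ hρ (fun ξ h => h.2) (inter_subset_left.trans hball)
  refine (measure_mono hsub).trans ((measure_iUnion_le _).trans ?_)
  rw [tsum_fintype]
  refine (Finset.sum_le_sum fun l _ => (measure_union_le _ _).trans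
    (add_le_add (hpart l 0) (hpart l 1))).trans ?_
  rw [Finset.sum_const, Finset.card_univ, Fintype.card_fin, nsmul_eq_mul]
  push_cast
  exact le_of_eq (by ring)

/-! ### Spline patches -/

theorem volume_hyperplane {d : ℕ} (l : Fin d) (s : ℝ) : volume {ξ : E d | ξ l = s} = 0 := by
  have h : MeasurableSet {y : Fin d → ℝ | y l = s} :=
    measurableSet_eq_fun (measurable_pi_apply l) measurable_const
  refine ((PiLp.volume_preserving_ofLp (Fin d)).measure_preimage h.nullMeasurableSet).trans ?_
  exact Measure.pi_hyperplane (fun _ : Fin d => (volume : Measure ℝ)) l s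

theorem openCube_subset_closedCube (d : ℕ) : openCube d ⊆ closedCube d :=
  fun _ h l => Ioo_subset_Icc_self (h l)

namespace Patch

variable {d k α : ℕ} (P : Patch d k α)

/-- Lower corner of a parametric element. -/
def lo (J : P.Idx) (l : Fin d) : ℝ := P.ζ l (J l).castSucc

/-- Upper corner of a parametric element. -/
def hi (J : P.Idx) (l : Fin d) : ℝ := P.ζ l (J l).succ

/-- The closed parametric element. -/
def cl (J : P.Idx) : Set (E d) := closedBox (P.lo J) (P.hi J)

theorem paramElem_eq (J : P.Idx) : P.paramElem J = openBox (P.lo J) (P.hi J) := rfl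

theorem lo_lt_hi (J : P.Idx) (l : Fin d) : P.lo J l < P.hi J l :=
  P.ζ_strictMono l (Fin.castSucc_lt_succ)

theorem ζ_mem (l : Fin d) (i : Fin (P.n l + 1)) : P.ζ l i ∈ Icc (0 : ℝ) 1 := by
  constructor
  · rw [← P.ζ_zero l]; exact (P.ζ_strictMono l).monotone (Fin.zero_le i)
  · rw [← P.ζ_last l]; exact (P.ζ_strictMono l).monotone (Fin.le_last i)

theorem cl_subset (J : P.Idx) : P.cl J ⊆ closedCube d := fun _ h l =>
  ⟨(P.ζ_mem l _).1.trans (h l).1, (h l).2.trans (P.ζ_mem l _).2⟩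

theorem paramElem_subset_cl (J : P.Idx) : P.paramElem J ⊆ P.cl J := openBox_subset_closedBox _ _

theorem paramElem_subset_openCube (J : P.Idx) : P.paramElem J ⊆ openCube d := fun _ h l =>
  ⟨(P.ζ_mem l _).1.trans_lt (h l).1, (h l).2.trans_le (P.ζ_mem l _).2⟩

/-- Every parameter lies in some closed knot span. -/
theorem exists_span (l : Fin d) {t : ℝ} (ht : t ∈ Icc (0 : ℝ) 1) :
    ∃ j : Fin (P.n l), t ∈ Icc (P.ζ l j.castSucc) (P.ζ l j.succ) := by
  have key : ∀ i : Fin (P.n l + 1),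
      (∃ j : Fin (P.n l), t ∈ Icc (P.ζ l j.castSucc) (P.ζ l j.succ)) ∨ P.ζ l i ≤ t := by
    intro i
    induction i using Fin.induction with
    | zero => exact Or.inr (by rw [P.ζ_zero]; exact ht.1)
    | succ i ih =>
      rcases ih with h | h
      · exact Or.inl h
      · rcases le_total t (P.ζ l i.succ) with h' | h'
        · exact Or.inl ⟨i, h, h'⟩
        · exact Or.inr h'
  rcases key (Fin.last _) with h | h
  · exact h
  · rw [P.ζ_last] at h
    have hn : P.n l ≠ 0 := fun hn => by
      have h0 : (0 : Fin (P.n l + 1)) = Fin.last (P.n l) := by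
        ext; simp [hn]
      have := P.ζ_zero l
      rw [h0, P.ζ_last] at this
      exact one_ne_zero this
    refine ⟨⟨P.n l - 1, by omega⟩, ?_⟩
    have hs : (⟨P.n l - 1, by omega⟩ : Fin (P.n l)).succ = Fin.last (P.n l) := by
      ext; simp only [Fin.succ_mk, Fin.val_last]; omega
    rw [hs, P.ζ_last]
    exact ⟨(P.ζ_mem l _).2.trans h, ht.2⟩

theorem closedCube_subset_iUnion_cl : closedCube d ⊆ ⋃ J, P.cl J := by
  intro ξ hξ
  choose J hJ using fun l => P.exists_span l (hξ l)
  exact mem_iUnion.2 ⟨J, hJ⟩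

theorem closure_paramElem (J : P.Idx) : closure (P.paramElem J) = P.cl J :=
  closure_openBox (P.lo_lt_hi J)

variable {P} {K : ℝ≥0}

theorem BiLipschitz.lipschitzOnWith (hP : P.BiLipschitz K) : LipschitzOnWith K P.F (closedCube d) :=
  LipschitzOnWith.of_dist_le_mul fun _ hx _ hy => (hP _ hx _ hy).1

theorem BiLipschitz.continuousOn (hP : P.BiLipschitz K) : ContinuousOn P.F (closedCube d) :=
  hP.lipschitzOnWith.continuousOn

theorem BiLipschitz.injOn (hP : P.BiLipschitz K) : InjOn P.F (closedCube d) := fun x hx y hy h => by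
  have := (hP x hx y hy).2
  rw [h, dist_self, mul_zero] at this
  exact dist_le_zero.1 this

/-- The inverse of the parametrization on the image of the closed cube; the values elsewhere are
unspecified. -/
def inv (P : Patch d k α) : E d → E d := Function.invFunOn P.F (closedCube d)

theorem BiLipschitz.inv_F (hP : P.BiLipschitz K) {ξ : E d} (hξ : ξ ∈ closedCube d) :
    P.inv (P.F ξ) = ξ :=
  hP.injOn.leftInvOn_invFunOn hξ

theorem BiLipschitz.continuousOn_inv (hP : P.BiLipschitz K) :
    ContinuousOn P.inv (P.F '' closedCube d) := by
  refine LipschitzOnWith.continuousOn (K := K) (LipschitzOnWith.of_dist_le_mul ?_)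
  rintro _ ⟨x, hx, rfl⟩ _ ⟨y, hy, rfl⟩
  rw [hP.inv_F hx, hP.inv_F hy]
  exact (hP x hx y hy).2

theorem BiLipschitz.isCompact_image_cl (hP : P.BiLipschitz K) (J : P.Idx) :
    IsCompact (P.F '' P.cl J) :=
  (isCompact_closedBox _ _).image_of_continuousOn (hP.continuousOn.mono (P.cl_subset J))

theorem elem_subset_image_cl (J : P.Idx) : P.elem J ⊆ P.F '' P.cl J :=
  image_mono (P.paramElem_subset_cl J)

theorem BiLipschitz.isBounded_elem (hP : P.BiLipschitz K) (J : P.Idx) :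
    Bornology.IsBounded (P.elem J) :=
  (hP.isCompact_image_cl J).isBounded.subset (elem_subset_image_cl J)

theorem BiLipschitz.volume_elem_ne_top (hP : P.BiLipschitz K) (J : P.Idx) :
    volume (P.elem J) ≠ ⊤ :=
  (hP.isBounded_elem J).measure_lt_top.ne

theorem BiLipschitz.measurableSet_elem (hP : P.BiLipschitz K) (J : P.Idx) :
    MeasurableSet (P.elem J) :=
  (isOpen_openBox _ _).measurableSet.image_of_continuousOn_injOn
    (hP.continuousOn.mono ((P.paramElem_subset_cl J).trans (P.cl_subset J)))
    (hP.injOn.mono ((P.paramElem_subset_cl J).trans (P.cl_subset J)))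

theorem BiLipschitz.disjoint_elem (hP : P.BiLipschitz K) {J J' : P.Idx} (h : J ≠ J') :
    Disjoint (P.elem J) (P.elem J') := by
  rw [Set.disjoint_left]
  rintro _ ⟨x, hx, rfl⟩ ⟨y, hy, hxy⟩
  have hxy' := hP.injOn (P.cl_subset _ (P.paramElem_subset_cl _ hy))
    (P.cl_subset _ (P.paramElem_subset_cl _ hx)) hxy
  subst hxy'
  obtain ⟨l, hl⟩ := Function.ne_iff.1 h
  have aux : ∀ i j : Fin (P.n l), i < j → y l < P.ζ l i.succ → P.ζ l j.castSucc < y l → False := by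
    intro i j hij h1 h2
    have : P.ζ l i.succ ≤ P.ζ l j.castSucc :=
      (P.ζ_strictMono l).monotone (Fin.succ_le_castSucc_iff.2 hij)
    linarith
  rcases lt_or_gt_of_ne hl with h' | h'
  · exact aux _ _ h' (hx l).2 (hy l).1
  · exact aux _ _ h' (hy l).2 (hx l).1

/-- The mesh skeleton is a null set. -/
theorem BiLipschitz.volume_skeleton (hP : P.BiLipschitz K) :
    volume (P.domain \ ⋃ J, P.elem J) = 0 := by
  set Z : Set (E d) := openCube d \ ⋃ J, P.paramElem J with hZ
  have hZ0 : volume Z = 0 := by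
    refine measure_mono_null (t := ⋃ l : Fin d, ⋃ i : Fin (P.n l + 1), {ξ : E d | ξ l = P.ζ l i})
      ?_ (measure_iUnion_null fun l => measure_iUnion_null fun i => volume_hyperplane l _)
    rintro ξ ⟨hξ, hn⟩
    by_contra hc
    simp only [mem_iUnion, mem_ofPred_eq, not_exists] at hc
    obtain ⟨J, hJ⟩ := mem_iUnion.1 (P.closedCube_subset_iUnion_cl (openCube_subset_closedCube d hξ))
    exact hn (mem_iUnion.2 ⟨J, fun l =>
      ⟨lt_of_le_of_ne (hJ l).1 (Ne.symm (hc l _)), lt_of_le_of_ne (hJ l).2 (hc l _)⟩⟩)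
  have hsub : P.domain \ ⋃ J, P.elem J ⊆ P.F '' Z := by
    rintro _ ⟨⟨ξ, hξ, rfl⟩, hn⟩
    refine ⟨ξ, ⟨hξ, fun h => hn ?_⟩, rfl⟩
    obtain ⟨J, hJ⟩ := mem_iUnion.1 h
    exact mem_iUnion.2 ⟨J, ξ, hJ, rfl⟩
  refine measure_mono_null hsub (le_antisymm ((volume_image_le
    (hP.lipschitzOnWith.mono (sdiff_subset.trans (openCube_subset_closedCube d)))).trans ?_)
    zero_le)
  rw [hZ0, mul_zero]

/-- The elements are dense in the predomain. -/
theorem BiLipschitz.domain_subset_closure (hP : P.BiLipschitz K) {U : Set (E d)} (hU : IsOpen U)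
    (hUP : U ⊆ P.domain) : U ⊆ ⋃ J, closure (P.elem J ∩ U) := by
  intro x hx
  obtain ⟨ξ, hξ, rfl⟩ := hUP hx
  obtain ⟨J, hJ⟩ := mem_iUnion.1 (P.closedCube_subset_iUnion_cl (openCube_subset_closedCube d hξ))
  refine mem_iUnion.2 ⟨J, ?_⟩
  have hcl : P.F ξ ∈ closure (P.elem J) := by
    have h1 : ξ ∈ closure (P.paramElem J) := by rwa [closure_paramElem]
    exact ((hP.continuousOn ξ (P.cl_subset J hJ)).mono
      ((P.paramElem_subset_cl J).trans (P.cl_subset J))).mem_closure_image h1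
  rw [inter_comm]
  exact hU.inter_closure ⟨hx, hcl⟩

theorem BiLipschitz.frontier_subset (hP : P.BiLipschitz K) :
    frontier P.domain ⊆ P.F '' (closedCube d \ openCube d) := by
  intro x hx
  have hcl : closure P.domain ⊆ P.F '' closedCube d :=
    closure_minimal (image_mono (openCube_subset_closedCube d))
      ((isCompact_closedBox _ _).image_of_continuousOn hP.continuousOn).isClosed
  obtain ⟨ξ, hξ, rfl⟩ := hcl hx.1
  refine ⟨ξ, ⟨hξ, fun h => hx.2 ?_⟩, rfl⟩
  have hopen : IsOpen P.domain := P.isOpen_image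
  rw [hopen.interior_eq]
  exact ⟨ξ, h, rfl⟩

/-- On each closed element the parametrization is a polynomial map, whose Jacobian determinant is
bounded above and below. -/
theorem BiLipschitz.exists_polynomial_chart (hP : P.BiLipschitz K) (J : P.Idx) :
    ∃ G : E d → E d, ContDiff ℝ 1 G ∧ EqOn P.F G (P.cl J) ∧
      (∀ ξ ∈ P.paramElem J, HasFDerivAt P.F (fderiv ℝ G ξ) ξ) ∧
      ∀ ξ ∈ P.cl J, |(fderiv ℝ G ξ).det| ≤ K ^ d ∧ 1 ≤ K ^ d * |(fderiv ℝ G ξ).det| := by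
  choose p hp hpF using fun l => exists_tensorPoly_of_mem_splineSpace (fun _ => le_refl k)
    (P.F_mem l) J
  set G : E d → E d := fun ξ => WithLp.toLp 2 fun l => p l ξ
  have hG : ContDiff ℝ 1 G := by
    rw [contDiff_euclidean]
    exact fun l => contDiff_of_mem_tensorPoly (hp l) 1
  have hFG : EqOn P.F G (P.cl J) := fun ξ hξ => by
    ext l
    exact hpF l hξ
  have hnhds : ∀ ξ ∈ P.paramElem J, P.paramElem J ∈ 𝓝 ξ := fun ξ hξ =>
    (isOpen_openBox _ _).mem_nhds hξ
  have hder : ∀ ξ ∈ P.paramElem J, HasFDerivAt P.F (fderiv ℝ G ξ) ξ := fun ξ hξ => by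
    refine ((hG.differentiable one_ne_zero) ξ).hasFDerivAt.congr_of_eventuallyEq ?_
    filter_upwards [hnhds ξ hξ] with η hη using hFG (P.paramElem_subset_cl J hη)
  refine ⟨G, hG, hFG, hder, fun ξ hξ => ?_⟩
  have hcont : Continuous fun ξ => |(fderiv ℝ G ξ).det| :=
    (ContinuousLinearMap.continuous_det.comp (hG.continuous_fderiv one_ne_zero)).abs
  have hopen : ∀ ξ ∈ P.paramElem J,
      |(fderiv ℝ G ξ).det| ≤ K ^ d ∧ 1 ≤ K ^ d * |(fderiv ℝ G ξ).det| := by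
    intro ξ hξ
    have hb := fderiv_bounds (K := K) (hnhds ξ hξ) (hder ξ hξ).differentiableAt fun η hη =>
      hP η (P.cl_subset J (P.paramElem_subset_cl J hη)) ξ
        (P.cl_subset J (P.paramElem_subset_cl J hξ))
    rw [(hder ξ hξ).fderiv] at hb
    exact abs_det_bounds (fun v => (hb v).1) (fun v => (hb v).2)
  have hclosed : IsClosed {ξ | |(fderiv ℝ G ξ).det| ≤ K ^ d ∧ 1 ≤ K ^ d * |(fderiv ℝ G ξ).det|} :=
    (isClosed_le hcont continuous_const).inter
      (isClosed_le continuous_const (continuous_const.mul hcont))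
  rw [← closure_paramElem] at hξ
  exact closure_minimal hopen hclosed hξ

/-- A function with continuous pull-back on a closed element extends continuously to the closure of
the physical element. -/
theorem BiLipschitz.exists_continuousOn_of_pullback (hP : P.BiLipschitz K) (J : P.Idx)
    {V : Type*} [TopologicalSpace V] {f g : E d → V} (hg : ContinuousOn g (P.cl J))
    (hfg : ∀ ξ ∈ P.paramElem J, f (P.F ξ) = g ξ) :
    ∃ h : E d → V, ContinuousOn h (P.F '' P.cl J) ∧ EqOn f h (P.elem J) := by
  refine ⟨g ∘ P.inv, hg.comp (hP.continuousOn_inv.mono (image_mono (P.cl_subset J))) ?_, ?_⟩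
  · rintro _ ⟨ξ, hξ, rfl⟩
    rw [hP.inv_F (P.cl_subset J hξ)]
    exact hξ
  · rintro _ ⟨ξ, hξ, rfl⟩
    rw [hfg ξ hξ, Function.comp, hP.inv_F (P.cl_subset J (P.paramElem_subset_cl J hξ))]

/-- In every family the pull-back of a discrete pressure is, on an element, a polynomial divided by
a function that is bounded above and away from zero. -/
theorem BiLipschitz.exists_pressure_pullback (hP : P.BiLipschitz K) (hK : 1 ≤ K) (J : P.Idx)
    {t : ElementType} {q : E d → ℝ} (hq : q ∈ P.presStar t) :
    ∃ p ∈ tensorPoly d k, ∃ δ : E d → ℝ, Continuous δ ∧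
      (∀ ξ ∈ P.cl J, |δ ξ| ≤ K ^ d ∧ 1 ≤ K ^ d * |δ ξ|) ∧
      ∀ ξ ∈ P.paramElem J, δ ξ * q (P.F ξ) = p ξ := by
  obtain ⟨G, hG, hFG, hder, hdet⟩ := hP.exists_polynomial_chart J
  obtain ⟨s, hs, hsq⟩ := hq
  obtain ⟨p, hp, hpF⟩ := exists_tensorPoly_of_mem_splineSpace (fun _ => le_refl k) hs J
  have hps : ∀ ξ ∈ P.paramElem J, P.pullPres t q ξ = p ξ := fun ξ hξ =>
    (hsq J hξ).trans (hpF (P.paramElem_subset_cl J hξ))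
  have hcont : Continuous fun ξ => (fderiv ℝ G ξ).det :=
    ContinuousLinearMap.continuous_det.comp (hG.continuous_fderiv one_ne_zero)
  refine ⟨p, hp, ?_⟩
  have hK1 : (1 : ℝ) ≤ (K : ℝ) ^ d := one_le_pow₀ (by exact_mod_cast hK)
  cases t with
  | RT => exact ⟨_, hcont, hdet, fun ξ hξ => by
      rw [← hps ξ hξ, pullPres, (hder ξ hξ).fderiv]⟩
  | N => exact ⟨_, hcont, hdet, fun ξ hξ => by
      rw [← hps ξ hξ, pullPres, (hder ξ hξ).fderiv]⟩
  | TH => exact ⟨fun _ => 1, continuous_const, fun ξ _ => by simpa using hK1, fun ξ hξ => by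
      rw [← hps ξ hξ, pullPres, one_mul]⟩

theorem BiLipschitz.exists_continuousOn_pressure (hP : P.BiLipschitz K) (hK : 1 ≤ K) (J : P.Idx)
    {t : ElementType} {q : E d → ℝ} (hq : q ∈ P.presStar t) :
    ∃ h : E d → ℝ, ContinuousOn h (P.F '' P.cl J) ∧ EqOn q h (P.elem J) := by
  obtain ⟨p, hp, δ, hδ, hδb, hqp⟩ := hP.exists_pressure_pullback hK J hq
  have hδ0 : ∀ ξ ∈ P.cl J, δ ξ ≠ 0 := fun ξ hξ h0 => by
    have := (hδb ξ hξ).2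
    rw [h0, abs_zero, mul_zero] at this
    exact absurd this (by norm_num)
  refine hP.exists_continuousOn_of_pullback J (g := fun ξ => p ξ / δ ξ)
    ((contDiff_of_mem_tensorPoly hp 0).continuous.continuousOn.div hδ.continuousOn hδ0)
    fun ξ hξ => ?_
  rw [eq_div_iff (hδ0 ξ (P.paramElem_subset_cl J hξ)), ← hqp ξ hξ, mul_comm]

theorem BiLipschitz.exists_continuousOn_velocity (hP : P.BiLipschitz K) (J : P.Idx)
    {t : ElementType} {v : E d → E d} (hv : v ∈ P.velStar t) :
    ∃ h : E d → E d, ContinuousOn h (P.F '' P.cl J) ∧ EqOn v h (P.elem J) := by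
  obtain ⟨G, hG, hFG, hder, hdet⟩ := hP.exists_polynomial_chart J
  obtain ⟨w, hw, hvw⟩ := hv
  have hwc : ContinuousOn w (P.cl J) := by
    have hdeg : ∀ l m : Fin d, t.velDegree k l m ≤ k + 1 := fun l m => by
      cases t
      · simp only [ElementType.velDegree]; split_ifs <;> omega
      · exact le_rfl
      · exact le_rfl
    choose p hp hpw using fun l => exists_tensorPoly_of_mem_splineSpace (hdeg l) (hw l) J
    have hc : Continuous fun ξ : E d => (WithLp.toLp 2 fun l => p l ξ : E d) :=
      (PiLp.continuous_toLp 2 _).comp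
        (continuous_pi fun l => (contDiff_of_mem_tensorPoly (hp l) 0).continuous)
    refine hc.continuousOn.congr fun ξ hξ => ?_
    ext l
    exact hpw l hξ
  have hD := hG.continuous_fderiv one_ne_zero
  have hdet0 : ∀ ξ ∈ P.cl J, (fderiv ℝ G ξ).det ≠ 0 := fun ξ hξ h0 => by
    have := (hdet ξ hξ).2
    rw [h0, abs_zero, mul_zero] at this
    exact absurd this (by norm_num)
  have hpiola : ContinuousOn (fun ξ => (fderiv ℝ G ξ).det⁻¹ • fderiv ℝ G ξ (w ξ)) (P.cl J) :=
    ((ContinuousLinearMap.continuous_det.comp hD).continuousOn.inv₀ hdet0).smul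
      (hD.continuousOn.clm_apply hwc)
  have hpiola_eq : ∀ ξ ∈ P.paramElem J,
      (fderiv ℝ P.F ξ).det • (fderiv ℝ P.F ξ).inverse (v (P.F ξ)) = w ξ →
      v (P.F ξ) = (fderiv ℝ G ξ).det⁻¹ • fderiv ℝ G ξ (w ξ) := by
    intro ξ hξ h
    have h0 := hdet0 ξ (P.paramElem_subset_cl J hξ)
    rw [← h, (hder ξ hξ).fderiv, map_smul, smul_smul, inv_mul_cancel₀ h0, one_smul]
    set e := (fderiv ℝ G ξ).toContinuousLinearEquivOfDetNeZero h0
    have he : fderiv ℝ G ξ = (e : E d →L[ℝ] E d) := by ext; rfl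
    rw [he, ContinuousLinearMap.inverse_equiv]
    simp
  cases t with
  | RT => exact hP.exists_continuousOn_of_pullback J hpiola fun ξ hξ => hpiola_eq ξ hξ (hvw J hξ)
  | N => exact hP.exists_continuousOn_of_pullback J hpiola fun ξ hξ => hpiola_eq ξ hξ (hvw J hξ)
  | TH => exact hP.exists_continuousOn_of_pullback J hwc fun ξ hξ => hvw J hξ

/-! ### Volumes and integrals on physical elements -/

theorem BiLipschitz.volume_paramElem_le (hP : P.BiLipschitz K) (J : P.Idx) :
    volume (P.paramElem J) ≤ K ^ d * volume (P.elem J) :=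
  volume_le_image fun x hx y hy => (hP x (P.cl_subset J (P.paramElem_subset_cl J hx)) y
    (P.cl_subset J (P.paramElem_subset_cl J hy))).2

theorem BiLipschitz.volume_elem_ne_zero (hP : P.BiLipschitz K) (J : P.Idx) :
    volume (P.elem J) ≠ 0 := by
  intro h
  have := hP.volume_paramElem_le J
  rw [h, mul_zero, P.paramElem_eq, volume_openBox (P.lo_lt_hi J), le_zero_iff,
    ENNReal.ofReal_eq_zero] at this
  exact absurd this (not_le.2 (Finset.prod_pos fun l _ => sub_pos.2 (P.lo_lt_hi J l)))

theorem BiLipschitz.diam_elem_pos [NeZero d] (hP : P.BiLipschitz K) (J : P.Idx) :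
    0 < Metric.diam (P.elem J) := by
  refine Metric.diam_pos ?_ (hP.isBounded_elem J)
  by_contra h
  exact hP.volume_elem_ne_zero J ((not_nontrivial_iff.1 h).measure_zero _)

/-- On a shape regular mesh the volume of an element is comparable to a power of its size. -/
theorem BiLipschitz.diam_pow_le_volume (hP : P.BiLipschitz K) {κ : ℝ≥0} (hκ : P.ShapeRegular κ)
    (J : P.Idx) :
    ENNReal.ofReal (Metric.diam (P.elem J)) ^ d ≤ ((K * κ * K) ^ d : ℝ≥0) * volume (P.elem J) := by
  have hbd : Bornology.IsBounded (P.paramElem J) :=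
    (isCompact_closedBox _ _).isBounded.subset (P.paramElem_subset_cl J)
  have h1 : Metric.diam (P.elem J) ≤ K * Metric.diam (P.paramElem J) := by
    refine Metric.diam_le_of_forall_dist_le (by positivity) ?_
    rintro _ ⟨x, hx, rfl⟩ _ ⟨y, hy, rfl⟩
    refine (hP x (P.cl_subset J (P.paramElem_subset_cl J hx)) y
      (P.cl_subset J (P.paramElem_subset_cl J hy))).1.trans ?_
    exact mul_le_mul_of_nonneg_left (Metric.dist_le_diam_of_mem hbd hx hy) K.coe_nonneg
  have h2 : Metric.diam (P.elem J) ^ d ≤ (K * κ) ^ d * ∏ l, (P.hi J l - P.lo J l) := by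
    calc Metric.diam (P.elem J) ^ d ≤ ∏ l : Fin d, (K * κ * (P.hi J l - P.lo J l)) := by
          rw [← Fin.prod_const]
          refine Finset.prod_le_prod (fun _ _ => Metric.diam_nonneg) fun l _ => h1.trans ?_
          rw [mul_assoc]
          exact mul_le_mul_of_nonneg_left (hκ J l) K.coe_nonneg
      _ = _ := by rw [Finset.prod_mul_distrib, Fin.prod_const]
  calc ENNReal.ofReal (Metric.diam (P.elem J)) ^ d
      = ENNReal.ofReal (Metric.diam (P.elem J) ^ d) := (ENNReal.ofReal_pow Metric.diam_nonneg _).symm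
    _ ≤ ENNReal.ofReal ((K * κ) ^ d * ∏ l, (P.hi J l - P.lo J l)) := ENNReal.ofReal_le_ofReal h2
    _ = ((K * κ) ^ d : ℝ≥0) * volume (P.paramElem J) := by
        rw [P.paramElem_eq, volume_openBox (P.lo_lt_hi J), ENNReal.ofReal_mul (by positivity)]
        congr 1
        rw [← ENNReal.ofReal_coe_nnreal]
        push_cast
        rfl
    _ ≤ ((K * κ) ^ d : ℝ≥0) * (K ^ d * volume (P.elem J)) :=
        mul_le_mul_right (hP.volume_paramElem_le J) _
    _ = _ := by rw [← mul_assoc, mul_pow _ K]; push_cast; rfl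

end Patch

/-- Norm equivalence for discrete pressures: on a physical element a pressure is controlled
pointwise by its mean square over any subset of positive density. -/
theorem pressure_sup_le (d k α : ℕ) {K : ℝ≥0} (hK : 1 ≤ K) {θ : ℝ≥0} (hθ : 0 < θ) : ∃ M : ℝ≥0,
    ∀ (P : Patch d k α), P.BiLipschitz K → ∀ (J : P.Idx) (t : ElementType),
      ∀ q ∈ P.presStar t, ∀ S ⊆ P.elem J, MeasurableSet S →
      θ * volume (P.elem J) ≤ volume S →
      ∀ x ∈ P.elem J, ‖q x‖ₑ ^ 2 * volume (P.elem J) ≤ M * ∫⁻ y in S, ‖q y‖ₑ ^ 2 := by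
  have hK0 : 0 < K := zero_lt_one.trans_le hK
  obtain ⟨M, hM⟩ := remez_tensorPoly k d
    (show (0 : ℝ) < ((K ^ d)⁻¹ * (θ * (K ^ d)⁻¹) : ℝ≥0) by exact_mod_cast (by positivity))
  refine ⟨(K ^ d) ^ 2 * (θ⁻¹ * K ^ d) * (M * ((K ^ d) ^ 2 * K ^ d)),
    fun P hP J t q hq S hS hSm hvol x hx => ?_⟩
  obtain ⟨G, hG, hFG, hder, hdet⟩ := hP.exists_polynomial_chart J
  obtain ⟨p, hp, δ, hδ, hδb, hqp⟩ := hP.exists_pressure_pullback hK J hq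
  set c : ℝ≥0 := K ^ d with hc
  have hc0 : c ≠ 0 := (pow_pos hK0 d).ne'
  have hcE : (c : ℝ≥0∞) = (K : ℝ≥0∞) ^ d := by rw [hc]; push_cast; rfl
  have hpc := P.paramElem_subset_cl J
  set S' : Set (E d) := P.paramElem J ∩ G ⁻¹' S with hS'
  have hS'm : MeasurableSet S' :=
    (isOpen_openBox _ _).measurableSet.inter (hG.continuous.measurable hSm)
  have himg : P.F '' S' = S := by
    ext y
    constructor
    · rintro ⟨ξ, ⟨hξ, hξS⟩, rfl⟩
      rw [hFG (hpc hξ)]; exact hξS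
    · intro hy
      obtain ⟨ξ, hξ, rfl⟩ := hS hy
      exact ⟨ξ, ⟨hξ, by rw [mem_preimage, ← hFG (hpc hξ)]; exact hy⟩, rfl⟩
  have hS'cube : S' ⊆ closedCube d := inter_subset_left.trans (hpc.trans (P.cl_subset J))
  have hvolS : volume S ≤ c * volume S' := by
    rw [← himg, hcE]; exact volume_image_le (hP.lipschitzOnWith.mono hS'cube)
  have hS'vol : ENNReal.ofReal (((c⁻¹ * (θ * c⁻¹) : ℝ≥0) : ℝ) * ∏ l, (P.hi J l - P.lo J l)) ≤
      volume S' := by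
    rw [ENNReal.ofReal_mul (NNReal.coe_nonneg _), ENNReal.ofReal_coe_nnreal,
      ← volume_openBox (P.lo_lt_hi J), ← P.paramElem_eq]
    calc ((c⁻¹ * (θ * c⁻¹) : ℝ≥0) : ℝ≥0∞) * volume (P.paramElem J)
        ≤ ((c⁻¹ * (θ * c⁻¹) : ℝ≥0) : ℝ≥0∞) * (c * volume (P.elem J)) := by
          gcongr; rw [hcE]; exact hP.volume_paramElem_le J
      _ = (c⁻¹ : ℝ≥0) * (θ * volume (P.elem J)) := by
          have h : c⁻¹ * θ * c⁻¹ * c = c⁻¹ * θ := by field_simp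
          rw [← mul_assoc, ← mul_assoc, ← ENNReal.coe_mul, h, ENNReal.coe_mul, mul_assoc]
      _ ≤ (c⁻¹ : ℝ≥0) * (c * volume S') := mul_le_mul_right (hvol.trans hvolS) _
      _ = volume S' := by
          rw [← mul_assoc, ← ENNReal.coe_mul, inv_mul_cancel₀ hc0, ENNReal.coe_one, one_mul]
  obtain ⟨ξ, hξ, rfl⟩ := hx
  have hrem := hM _ _ (P.lo_lt_hi J) p hp S' (inter_subset_left.trans hpc) hS'm hS'vol ξ (hpc hξ)
  -- `‖q ∘ F‖` and `‖p‖` are comparable because `δ` is.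
  have hqle : ∀ η ∈ P.paramElem J, ‖q (P.F η)‖ₑ ≤ c * ‖p η‖ₑ := by
    intro η hη
    rw [← hqp η hη, enorm_mul, ← mul_assoc]
    refine le_mul_of_one_le_left zero_le ?_
    rw [← ofReal_norm, ← ENNReal.ofReal_coe_nnreal, ← ENNReal.ofReal_mul c.coe_nonneg,
      ENNReal.one_le_ofReal]
    simpa [hc] using (hδb η (hpc hη)).2
  have hple : ∀ η ∈ P.paramElem J, ‖p η‖ₑ ≤ c * ‖q (P.F η)‖ₑ := by
    intro η hη
    rw [← hqp η hη, enorm_mul]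
    gcongr
    rw [← ofReal_norm, ← ENNReal.ofReal_coe_nnreal]
    refine ENNReal.ofReal_le_ofReal ?_
    simpa [hc] using (hδb η (hpc hη)).1
  have hint : ∫⁻ η in S', ‖p η‖ₑ ^ 2 ≤ (c ^ 2 * c : ℝ≥0) * ∫⁻ y in S, ‖q y‖ₑ ^ 2 := by
    rw [← himg, lintegral_image_eq_lintegral_abs_det_fderiv_mul volume hS'm
      (fun η hη => (hder η hη.1).hasFDerivWithinAt) (hP.injOn.mono hS'cube),
      ← lintegral_const_mul' _ _ ENNReal.coe_ne_top]
    refine setLIntegral_mono' hS'm fun η hη => ?_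
    have h1 : (1 : ℝ≥0∞) ≤ c * ENNReal.ofReal |(fderiv ℝ G η).det| := by
      rw [← ENNReal.ofReal_coe_nnreal, ← ENNReal.ofReal_mul c.coe_nonneg, ENNReal.one_le_ofReal]
      simpa [hc] using (hdet η (hpc hη.1)).2
    calc ‖p η‖ₑ ^ 2 ≤ (c * ‖q (P.F η)‖ₑ) ^ 2 := by gcongr; exact hple η hη.1
      _ = c ^ 2 * (1 * ‖q (P.F η)‖ₑ ^ 2) := by ring
      _ ≤ c ^ 2 * (c * ENNReal.ofReal |(fderiv ℝ G η).det| * ‖q (P.F η)‖ₑ ^ 2) := by gcongr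
      _ = _ := by push_cast; ring
  have hθv : volume (P.elem J) ≤ (θ⁻¹ * c : ℝ≥0) * volume S' := by
    calc volume (P.elem J) = (θ⁻¹ : ℝ≥0) * (θ * volume (P.elem J)) := by
          rw [← mul_assoc, ← ENNReal.coe_mul, inv_mul_cancel₀ hθ.ne', ENNReal.coe_one, one_mul]
      _ ≤ (θ⁻¹ : ℝ≥0) * (c * volume S') := mul_le_mul_right (hvol.trans hvolS) _
      _ = _ := by rw [← mul_assoc, ← ENNReal.coe_mul]
  calc ‖q (P.F ξ)‖ₑ ^ 2 * volume (P.elem J)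
      ≤ (c * ‖p ξ‖ₑ) ^ 2 * ((θ⁻¹ * c : ℝ≥0) * volume S') := by
        gcongr; exact hqle ξ hξ
    _ = (c ^ 2 * (θ⁻¹ * c) : ℝ≥0) * (‖p ξ‖ₑ ^ 2 * volume S') := by push_cast; ring
    _ ≤ (c ^ 2 * (θ⁻¹ * c) : ℝ≥0) * (M * ((c ^ 2 * c : ℝ≥0) * ∫⁻ y in S, ‖q y‖ₑ ^ 2)) := by
        exact mul_le_mul_right (hrem.trans (mul_le_mul_right hint _)) _
    _ = _ := by push_cast; ring

/-- A tensor product polynomial is controlled, in a ball, by its mean square over a subset of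
comparable volume. -/
theorem tensorPoly_sup_le_of_ball (d k : ℕ) {ρ c : ℝ≥0} (hρ : 0 < ρ) (hc : 0 < c) : ∃ M : ℝ≥0,
    ∀ r ∈ tensorPoly d k, ∀ (S : Set (E d)) (y : E d) (s : ℝ), 0 < s → MeasurableSet S →
      ENNReal.ofReal s ^ d ≤ c * volume S → S ⊆ Metric.closedBall y (ρ * s) →
      ∀ x ∈ Metric.closedBall y (ρ * s), ‖r x‖ₑ ^ 2 * volume S ≤ M * ∫⁻ y in S, ‖r y‖ₑ ^ 2 := by
  obtain ⟨M, hM⟩ := remez_tensorPoly k d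
    (show (0 : ℝ) < ((c * (2 * ρ) ^ d)⁻¹ : ℝ≥0) by exact_mod_cast (by positivity))
  refine ⟨M, fun r hr S y s hs hSm hvol hSball x hx => ?_⟩
  have hρs : 0 < ρ * s := mul_pos (by exact_mod_cast hρ) hs
  have hbox : Metric.closedBall y (ρ * s) ⊆
      closedBox (fun l => y l - ρ * s) (fun l => y l + ρ * s) := by
    intro z hz l
    have h1 := PiLp.norm_apply_le (z - y) l
    rw [Metric.mem_closedBall, dist_eq_norm] at hz
    have h2 : |z l - y l| ≤ ρ * s := h1.trans hz
    rw [abs_le] at h2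
    constructor <;> linarith [h2.1, h2.2]
  refine hM _ _ (fun l => by linarith) r hr S (hSball.trans hbox) hSm ?_ x (hbox hx)
  have h1 : (∏ l : Fin d, ((y l + ρ * s) - (y l - ρ * s))) = ((2 * ρ) ^ d : ℝ≥0) * s ^ d := by
    rw [← Fin.prod_const, Finset.prod_congr rfl fun l _ => (by ring :
      (y l + ρ * s) - (y l - ρ * s) = 2 * ρ * s), Fin.prod_const, Fin.prod_const, mul_pow]
    push_cast
    rfl
  rw [h1, ENNReal.ofReal_mul (NNReal.coe_nonneg _), ENNReal.ofReal_mul (NNReal.coe_nonneg _),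
    ENNReal.ofReal_coe_nnreal, ENNReal.ofReal_coe_nnreal, ENNReal.ofReal_pow hs.le, ← mul_assoc,
    ← ENNReal.coe_mul]
  have h2 : (c * (2 * ρ) ^ d)⁻¹ * (2 * ρ) ^ d = c⁻¹ := by field_simp
  rw [h2]
  calc ((c⁻¹ : ℝ≥0) : ℝ≥0∞) * ENNReal.ofReal s ^ d ≤ (c⁻¹ : ℝ≥0) * (c * volume S) := by gcongr
    _ = volume S := by
        rw [← mul_assoc, ← ENNReal.coe_mul, inv_mul_cancel₀ hc.ne', ENNReal.coe_one, one_mul]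

/-- The surface measure of the part of the boundary of a predomain in a set of radius `ρ`. -/
theorem frontier_measure_le (d k α : ℕ) (hd : d ≠ 0) (K : ℝ≥0) : ∃ C : ℝ≥0,
    ∀ (P : Patch d k α), P.BiLipschitz K → ∀ (T : Set (E d)) (x₀ : E d) (ρ : ℝ), 0 ≤ ρ →
      T ⊆ frontier P.domain → T ⊆ Metric.closedBall x₀ ρ →
      (μHE[d - 1] : Measure (E d)) T ≤ C * ENNReal.ofReal ρ ^ (d - 1) := by
  obtain ⟨n, rfl⟩ := Nat.exists_eq_succ_of_ne_zero hd
  obtain ⟨C, hC⟩ := cube_boundary_measure_le n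
  refine ⟨K ^ n * (C * (K * 2) ^ n), fun P hP T x₀ ρ hρ hT hball => ?_⟩
  simp only [Nat.succ_eq_add_one, Nat.add_sub_cancel] at *
  set T' : Set (E (n + 1)) := (closedCube (n + 1) \ openCube (n + 1)) ∩ P.F ⁻¹' T with hT'
  have hTT' : T ⊆ P.F '' T' := fun x hx => by
    obtain ⟨ξ, hξ, rfl⟩ := hP.frontier_subset (hT hx)
    exact ⟨ξ, ⟨hξ, hx⟩, rfl⟩
  rcases T'.eq_empty_or_nonempty with h | ⟨ξ₀, hξ₀⟩
  · rw [h, image_empty, subset_empty_iff] at hTT'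
    simp [hTT']
  have hT'ball : T' ⊆ Metric.closedBall ξ₀ (K * (2 * ρ)) := fun ξ hξ => by
    refine (hP ξ hξ.1.1 ξ₀ hξ₀.1.1).2.trans ?_
    have h1 : dist (P.F ξ) x₀ ≤ ρ := hball hξ.2
    have h2 : dist (P.F ξ₀) x₀ ≤ ρ := hball hξ₀.2
    gcongr
    linarith [dist_triangle_right (P.F ξ) (P.F ξ₀) x₀]
  refine (measure_mono hTT').trans ((euclideanHausdorffMeasure_image_le (hP.lipschitzOnWith.mono
    (inter_subset_left.trans sdiff_subset)) n).trans ?_)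
  refine (mul_le_mul_right (hC T' ξ₀ (K * (2 * ρ)) (by positivity) inter_subset_left hT'ball)
    _).trans (le_of_eq ?_)
  rw [← mul_assoc (K : ℝ), ENNReal.ofReal_mul (by positivity), ENNReal.ofReal_mul (by positivity),
    ENNReal.ofReal_coe_nnreal, ENNReal.ofReal_ofNat]
  push_cast
  ring

/-! ### Visible parts of the elements -/

namespace Overlap

variable {d k α N : ℕ} {D : Overlap d k α N} {K : ℝ≥0}

/-- The visible part of an element. -/
def part (D : Overlap d k α N) (a : D.Elem) : Set (E d) := D.cell a ∩ D.visible a.1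

theorem isClosed_covered (D : Overlap d k α N) (i : Fin (N + 1)) :
    IsClosed (⋃ l ∈ Ioi i, closure (D.patch l).domain) :=
  (toFinite _).isClosed_biUnion fun _ _ => isClosed_closure

theorem isOpen_visible (D : Overlap d k α N) (i : Fin (N + 1)) : IsOpen (D.visible i) :=
  (D.patch i).isOpen_image.sdiff (D.isClosed_covered i)

theorem measurableSet_iface (D : Overlap d k α N) (i j : Fin (N + 1)) :
    MeasurableSet (D.iface i j) :=
  (isClosed_frontier.measurableSet.diff (D.isClosed_covered i).measurableSet).inter
    isClosed_closure.measurableSet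

theorem measurableSet_part (hbi : ∀ i, (D.patch i).BiLipschitz K) (a : D.Elem) :
    MeasurableSet (D.part a) :=
  ((hbi a.1).measurableSet_elem a.2).inter (D.isOpen_visible a.1).measurableSet

theorem isActive_of_mem_closure {a : D.Elem} {x : E d} (hx : x ∈ closure (D.part a)) :
    D.IsActive a :=
  closure_nonempty_iff.1 ⟨x, hx⟩

/-- The mesh skeleton can be ignored in closures: visible points are limits of points of the visible
parts of the elements. -/
theorem closure_visible_subset (hbi : ∀ i, (D.patch i).BiLipschitz K) (i : Fin (N + 1)) :
    closure (D.visible i) ⊆ ⋃ J, closure (D.part ⟨i, J⟩) :=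
  closure_minimal ((hbi i).domain_subset_closure (D.isOpen_visible i) sdiff_subset)
    (isClosed_iUnion_of_finite fun _ => isClosed_closure)

theorem mem_touching {i : Fin (N + 1)} {x : E d} {J : (D.patch i).Idx} :
    J ∈ D.touching i x ↔ x ∈ closure (D.part ⟨i, J⟩) := by
  simp [touching, part, cell]

theorem touching_nonempty (hbi : ∀ i, (D.patch i).BiLipschitz K) {i : Fin (N + 1)} {x : E d}
    (hx : x ∈ closure (D.visible i)) : (D.touching i x).Nonempty := by
  obtain ⟨J, hJ⟩ := mem_iUnion.1 (closure_visible_subset hbi i hx)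
  exact ⟨J, mem_touching.2 hJ⟩

/-- Both patches of an interface reach each of its points. -/
theorem iface_subset_closure_visible (D : Overlap d k α N) (i j : Fin (N + 1)) :
    D.iface i j ⊆ closure (D.visible i) ∩ closure (D.visible j) := by
  rintro x ⟨⟨hx, hn⟩, hj⟩
  refine ⟨?_, hj⟩
  have := (D.isClosed_covered i).isOpen_compl.inter_closure (t := (D.patch i).domain) ⟨hn, hx.1⟩
  rwa [inter_comm, ← sdiff_eq] at this

/-! ### Traces of functions that extend continuously on each element -/

/-- A function that extends continuously from the visible part of each element to its closure. -/
def HasTraces (D : Overlap d k α N) (i : Fin (N + 1)) {V : Type*} [TopologicalSpace V]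
    (f : E d → V) : Prop :=
  ∀ J, ∃ h : E d → V, ContinuousOn h (closure (D.part ⟨i, J⟩)) ∧ EqOn f h (D.part ⟨i, J⟩)

theorem HasTraces.tendsto {V : Type*} [TopologicalSpace V] [T2Space V]
    {i : Fin (N + 1)} {f : E d → V} (hf : D.HasTraces i f) {J : (D.patch i).Idx} {x : E d}
    (hx : x ∈ closure (D.part ⟨i, J⟩)) :
    Tendsto f (𝓝[D.part ⟨i, J⟩] x) (𝓝 (extendFrom (D.part ⟨i, J⟩) f x)) := by
  obtain ⟨h, hh, hfh⟩ := hf J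
  have hlim : Tendsto f (𝓝[D.part ⟨i, J⟩] x) (𝓝 (h x)) := by
    refine Tendsto.congr' ?_ (((hh x hx).mono subset_closure).tendsto)
    filter_upwards [self_mem_nhdsWithin] with y hy using (hfh hy).symm
  rwa [extendFrom_eq hx hlim]

theorem HasTraces.continuousOn_extendFrom {V : Type*} [TopologicalSpace V] [T3Space V]
    {i : Fin (N + 1)} {f : E d → V} (hf : D.HasTraces i f) (J : (D.patch i).Idx) :
    ContinuousOn (extendFrom (D.part ⟨i, J⟩) f) (closure (D.part ⟨i, J⟩)) :=
  _root_.continuousOn_extendFrom Subset.rfl fun _ hx => ⟨_, hf.tendsto hx⟩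

theorem enorm_sub_sq_le {V : Type*} [NormedAddCommGroup V] (a b : V) : ‖a - b‖ₑ ^ 2 ≤ 2 * ‖a‖ₑ ^ 2 + 2 * ‖b‖ₑ ^ 2 := by
  have h1 : ‖a - b‖ ^ 2 ≤ 2 * ‖a‖ ^ 2 + 2 * ‖b‖ ^ 2 := by
    have := norm_sub_le a b
    nlinarith [sq_nonneg (‖a‖ - ‖b‖), norm_nonneg (a - b), norm_nonneg a, norm_nonneg b]
  simp only [← ofReal_norm, ← ENNReal.ofReal_pow (norm_nonneg _)]
  rw [← ENNReal.ofReal_ofNat, ← ENNReal.ofReal_mul zero_le_two, ← ENNReal.ofReal_mul zero_le_two,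
    ← ENNReal.ofReal_add (by positivity) (by positivity)]
  exact ENNReal.ofReal_le_ofReal h1

section Normed

variable {V : Type*} [NormedAddCommGroup V] [NormedSpace ℝ V]

theorem HasTraces.const_smul {i : Fin (N + 1)} {f : E d → V} (hf : D.HasTraces i f) (s : ℝ) :
    D.HasTraces i (s • f) := fun J => by
  obtain ⟨h, hh, hfh⟩ := hf J
  exact ⟨s • h, hh.const_smul s, fun x hx => by simp only [Pi.smul_apply, hfh hx]⟩

theorem trace_const_smul {i : Fin (N + 1)} {f : E d → V} (hf : D.HasTraces i f) (s : ℝ) (x : E d) :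
    D.trace i (s • f) x = s • D.trace i f x := by
  have h : ∀ J ∈ D.touching i x, extendFrom (D.part ⟨i, J⟩) (s • f) x =
      s • extendFrom (D.part ⟨i, J⟩) f x := fun J hJ =>
    extendFrom_eq (mem_touching.1 hJ) ((hf.tendsto (mem_touching.1 hJ)).const_smul s)
  calc D.trace i (s • f) x = ((D.touching i x).card : ℝ)⁻¹ • ∑ J ∈ D.touching i x,
        s • extendFrom (D.part ⟨i, J⟩) f x := congrArg _ (Finset.sum_congr rfl h)
    _ = s • D.trace i f x := by rw [← Finset.smul_sum, smul_comm]; rfl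

theorem sum_touching {A : Type*} [AddCommMonoid A] (i : Fin (N + 1)) (x : E d)
    (g : (D.patch i).Idx → E d → A) :
    ∑ J ∈ D.touching i x, g J x =
      ∑ J : (D.patch i).Idx, (closure (D.part ⟨i, J⟩)).indicator (g J) x := by
  classical
  rw [touching, Finset.sum_filter]
  refine Finset.sum_congr rfl fun J _ => ?_
  rw [Set.indicator_apply]
  rfl

theorem measurable_card_touching (D : Overlap d k α N) (i : Fin (N + 1)) :
    Measurable fun x => ((D.touching i x).card : ℝ) := by
  have h : (fun x => ((D.touching i x).card : ℝ)) = fun x =>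
      ∑ J : (D.patch i).Idx, (closure (D.part ⟨i, J⟩)).indicator (fun _ => (1 : ℝ)) x := by
    funext x
    rw [← sum_touching i x fun _ _ => (1 : ℝ), Finset.sum_const, nsmul_eq_mul, mul_one]
  rw [h]
  exact Finset.measurable_fun_sum _ fun J _ =>
    measurable_const.indicator isClosed_closure.measurableSet

theorem measurable_meshSize (D : Overlap d k α N) (i : Fin (N + 1)) : Measurable (D.meshSize i) := by
  have h : D.meshSize i = fun x => ((D.touching i x).card : ℝ)⁻¹ *
      ∑ J : (D.patch i).Idx, (closure (D.part ⟨i, J⟩)).indicator (fun _ => D.size ⟨i, J⟩) x :=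
    funext fun x => congrArg _ (sum_touching i x fun J _ => D.size ⟨i, J⟩)
  rw [h]
  exact (D.measurable_card_touching i).inv.mul (Finset.measurable_fun_sum _ fun J _ =>
    measurable_const.indicator isClosed_closure.measurableSet)

theorem measurable_ifaceSize (D : Overlap d k α N) (i j : Fin (N + 1)) :
    Measurable (D.ifaceSize i j) :=
  D.measurable_meshSize _

theorem HasTraces.measurable_trace [MeasurableSpace V] [BorelSpace V]
    [SecondCountableTopology V] {i : Fin (N + 1)} {f : E d → V} (hf : D.HasTraces i f) :
    Measurable (D.trace i f) := by
  classical
  have h : D.trace i f = fun x => ((D.touching i x).card : ℝ)⁻¹ • ∑ J : (D.patch i).Idx,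
      (closure (D.part ⟨i, J⟩)).indicator (extendFrom (D.part ⟨i, J⟩) f) x :=
    funext fun x => congrArg _ (sum_touching i x fun J => extendFrom (D.part ⟨i, J⟩) f)
  rw [h]
  refine (D.measurable_card_touching i).inv.smul (Finset.measurable_fun_sum _ fun J _ => ?_)
  rw [← piecewise_eq_indicator]
  exact (hf.continuousOn_extendFrom J).measurable_piecewise continuousOn_const
    isClosed_closure.measurableSet

/-- The square of a trace is at most the sum, over the touching elements, of any bounds for the
square of the function on these elements. -/
theorem HasTraces.enorm_trace_sq_le {i : Fin (N + 1)} {f : E d → V} (hf : D.HasTraces i f)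
    {B : D.Elem → ℝ≥0∞} (hB : ∀ J, ∀ x ∈ D.part ⟨i, J⟩, ‖f x‖ₑ ^ 2 ≤ B ⟨i, J⟩) (x : E d) :
    ‖D.trace i f x‖ₑ ^ 2 ≤ ∑ J ∈ D.touching i x, B ⟨i, J⟩ := by
  set T := D.touching i x with hT
  set g : (D.patch i).Idx → V := fun J => extendFrom (D.part ⟨i, J⟩) f x with hg
  have hgB : ∀ J ∈ T, ‖g J‖ₑ ^ 2 ≤ B ⟨i, J⟩ := by
    intro J hJ
    have hx := mem_touching.1 hJ
    have : (𝓝[D.part ⟨i, J⟩] x).NeBot := mem_closure_iff_nhdsWithin_neBot.1 hx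
    have hlim := ((ENNReal.continuous_pow 2).comp continuous_enorm).continuousAt.tendsto.comp
      (hf.tendsto hx)
    refine le_of_tendsto hlim ?_
    filter_upwards [self_mem_nhdsWithin] with y hy using hB J y hy
  have htr : D.trace i f x = (T.card : ℝ)⁻¹ • ∑ J ∈ T, g J := rfl
  rcases T.eq_empty_or_nonempty with h | h
  · rw [htr, h]; simp
  -- The norm of a mean is at most the largest of the norms.
  obtain ⟨J₀, hJ₀, hmax⟩ := T.exists_max_image (fun J => ‖g J‖) h
  have hcard : (0 : ℝ) < T.card := by exact_mod_cast h.card_pos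
  have hle : ‖D.trace i f x‖ ≤ ‖g J₀‖ := by
    rw [htr, norm_smul, norm_inv, RCLike.norm_natCast, inv_mul_le_iff₀ hcard]
    refine (norm_sum_le _ _).trans ((Finset.sum_le_sum hmax).trans ?_)
    rw [Finset.sum_const, nsmul_eq_mul]
  have hle' : ‖D.trace i f x‖ₑ ≤ ‖g J₀‖ₑ := by
    rw [← ofReal_norm, ← ofReal_norm]; exact ENNReal.ofReal_le_ofReal hle
  calc ‖D.trace i f x‖ₑ ^ 2 ≤ ‖g J₀‖ₑ ^ 2 := by gcongr
    _ ≤ B ⟨i, J₀⟩ := hgB J₀ hJ₀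
    _ ≤ ∑ J ∈ T, B ⟨i, J⟩ := Finset.single_le_sum (f := fun J => B ⟨i, J⟩) (fun _ _ => zero_le) hJ₀

end Normed

theorem closure_part_subset (hbi : ∀ i, (D.patch i).BiLipschitz K) (a : D.Elem) :
    closure (D.part a) ⊆ (D.patch a.1).F '' (D.patch a.1).cl a.2 :=
  closure_minimal (inter_subset_left.trans (Patch.elem_subset_image_cl a.2))
    ((hbi a.1).isCompact_image_cl a.2).isClosed

theorem hasTraces_of_mem_velSpace (hbi : ∀ i, (D.patch i).BiLipschitz K) {t : ElementType}
    {i : Fin (N + 1)} {w : E d → E d} (hw : w ∈ D.velSpace t i) : D.HasTraces i w := fun J => by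
  obtain ⟨v, hv, hwv⟩ := hw
  obtain ⟨h, hh, hvh⟩ := (hbi i).exists_continuousOn_velocity J hv
  exact ⟨h, hh.mono (closure_part_subset hbi ⟨i, J⟩),
    fun x hx => (hwv hx.2).trans (hvh hx.1)⟩

theorem hasTraces_of_mem_stabPres (hbi : ∀ i, (D.patch i).BiLipschitz K) (hK : 1 ≤ K)
    {t : ElementType} {θ : ℝ} {nb : D.Elem → D.Elem} {φ : Fin (N + 1) → E d → ℝ}
    (hφ : φ ∈ D.stabPres t θ nb) (i : Fin (N + 1)) : D.HasTraces i (φ i) := fun J => by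
  obtain ⟨q, hq, hgood, hbad⟩ := hφ
  by_cases hact : D.IsActive ⟨i, J⟩
  · by_cases hg : D.IsGood θ ⟨i, J⟩
    · obtain ⟨h, hh, hqh⟩ := (hbi i).exists_continuousOn_pressure hK J (hq i)
      exact ⟨h, hh.mono (closure_part_subset hbi ⟨i, J⟩),
        fun x hx => (hgood _ hg hx).trans (hqh hx.1)⟩
    · obtain ⟨r, hr, hφr⟩ := hbad ⟨i, J⟩ ⟨hact, hg⟩
      exact ⟨r, (contDiff_of_mem_tensorPoly hr.1.mem_tensorPoly 0).continuous.continuousOn, hφr⟩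
  · have : D.part ⟨i, J⟩ = ∅ := not_nonempty_iff_eq_empty.1 hact
    exact ⟨0, continuousOn_const, by simp [this]⟩

/-! ### Stability of the stabilized pressures -/

/-- The `L²` projection onto polynomials does not increase the norm. -/
theorem lintegral_proj_sq_le {S S' : Set (E d)} (hS : MeasurableSet S) (hS' : IsCompact S')
    (hSS' : S ⊆ S') {q h r : E d → ℝ} (hh : ContinuousOn h S') (hqh : EqOn q h S)
    (hr : IsL2Proj k S q r) : ∫⁻ x in S, ‖r x‖ₑ ^ 2 ≤ ∫⁻ x in S, ‖q x‖ₑ ^ 2 := by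
  have hrc : ContinuousOn r S' :=
    (contDiff_of_mem_tensorPoly hr.1.mem_tensorPoly 0).continuous.continuousOn
  have hint : ∀ f : E d → ℝ, ContinuousOn f S' → IntegrableOn f S := fun f hf =>
    (hf.integrableOn_compact hS').mono_set hSS'
  have horth : ∫ x in S, (h x - r x) * r x = 0 := by
    rw [← hr.2 r hr.1]
    exact setIntegral_congr_fun hS fun x hx => by simp only [hqh hx]
  have hle : ∫ x in S, r x ^ 2 ≤ ∫ x in S, h x ^ 2 := by
    have h1 : ∫ x in S, h x ^ 2 = ∫ x in S, (r x ^ 2 + (2 * ((h x - r x) * r x) + (h x - r x) ^ 2)) :=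
      integral_congr_ae (Eventually.of_forall fun x => by ring)
    rw [h1, integral_add (hint (fun x => r x ^ 2) (hrc.pow 2)), integral_add, integral_const_mul, horth]
    · have : 0 ≤ ∫ x in S, (h x - r x) ^ 2 := integral_nonneg fun x => sq_nonneg _
      linarith
    · exact hint _ (continuousOn_const.mul ((hh.sub hrc).mul hrc))
    · exact hint (fun x => (h x - r x) ^ 2) ((hh.sub hrc).pow 2)
    · exact hint _ ((continuousOn_const.mul ((hh.sub hrc).mul hrc)).add ((hh.sub hrc).pow 2))
  have hconv : ∀ f : E d → ℝ, ContinuousOn f S' →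
      ∫⁻ x in S, ‖f x‖ₑ ^ 2 = ENNReal.ofReal (∫ x in S, f x ^ 2) := fun f hf => by
    rw [ofReal_integral_eq_lintegral_ofReal (hint (fun x => f x ^ 2) (hf.pow 2))
      (Eventually.of_forall fun x => sq_nonneg _)]
    refine lintegral_congr fun x => ?_
    rw [← ofReal_norm, ← ENNReal.ofReal_pow (norm_nonneg _), Real.norm_eq_abs, sq_abs]
  calc ∫⁻ x in S, ‖r x‖ₑ ^ 2 ≤ ∫⁻ x in S, ‖h x‖ₑ ^ 2 := by
        rw [hconv r hrc, hconv h hh]; exact ENNReal.ofReal_le_ofReal hle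
    _ = ∫⁻ x in S, ‖q x‖ₑ ^ 2 := setLIntegral_congr_fun hS fun x hx => by simp only [hqh hx]

/-- A neighbor of `a` contains a point near all of `a`. Of the constant `R + 2`, one unit makes up for
an infimum that is not attained and one for the diameter of `a`. -/
theorem exists_dist_le_of_isNeighbor [NeZero d] (hbi : ∀ i, (D.patch i).BiLipschitz K) {R : ℝ≥0}
    {a b : D.Elem} (h : D.IsNeighbor R a b) : ∃ y ∈ D.cell b, ∀ x ∈ D.cell a,
      dist x y ≤ (R + 2) * D.size a := by
  have hpos : 0 < D.size a := (hbi a.1).diam_elem_pos a.2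
  have hlt : ⨅ x ∈ D.cell a, Metric.infEDist x (D.cell b) <
      ENNReal.ofReal ((R + 1) * D.size a) := by
    refine h.2.2.trans_lt ?_
    rw [ENNReal.ofReal_lt_ofReal_iff (by positivity)]
    linarith
  simp only [iInf_lt_iff] at hlt
  obtain ⟨x₀, hx₀, hx₀b⟩ := hlt
  obtain ⟨y, hy, hxy⟩ := Metric.infEDist_lt_iff.1 hx₀b
  refine ⟨y, hy, fun x hx => ?_⟩
  have h1 : dist x₀ y < (R + 1) * D.size a := by
    rw [edist_dist] at hxy
    exact (ENNReal.ofReal_lt_ofReal_iff (by positivity)).1 hxy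
  have h2 : dist x x₀ ≤ D.size a :=
    Metric.dist_le_diam_of_mem ((hbi a.1).isBounded_elem a.2) hx hx₀
  linarith [dist_triangle x x₀ y]

open Classical in
/-- The good element that determines a stabilized pressure on a given active element: the element
itself if it is good, its good neighbor otherwise. -/
def source (D : Overlap d k α N) (θ : ℝ) (nb : D.Elem → D.Elem) (a : D.Elem) : D.Elem :=
  if D.IsGood θ a then a else nb a

/-- The squared norm of a pressure on the visible part of an element. -/
def partSq (D : Overlap d k α N) (φ : Fin (N + 1) → E d → ℝ) (b : D.Elem) : ℝ≥0∞ :=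
  ∫⁻ x in D.part b, ‖φ b.1 x‖ₑ ^ 2

/-- On each active element a stabilized pressure is controlled pointwise by its mean square over
the visible part of the good element that determines it. -/
theorem stabPres_sup_le (d k α : ℕ) [NeZero d] {K θ κ σ : ℝ≥0} (R : ℝ≥0) (hK : 1 ≤ K) (hθ : 0 < θ)
    (hσ : 1 ≤ σ) (hκ0 : 0 < κ) : ∃ M : ℝ≥0, ∀ (N : ℕ) (D : Overlap d k α N) (nb : D.Elem → D.Elem)
    (t : ElementType), (∀ i, (D.patch i).BiLipschitz K) → (∀ i, (D.patch i).ShapeRegular κ) →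
    D.IsGoodNeighborMap θ R nb → (∀ a, D.IsBad θ a → D.size a ≤ σ * D.size (nb a)) →
    ∀ φ ∈ D.stabPres t θ nb, ∀ a, D.IsActive a → ∀ x ∈ D.part a,
      ‖φ a.1 x‖ₑ ^ 2 * volume (D.cell (D.source θ nb a)) ≤
        M * D.partSq φ (D.source θ nb a) := by
  have hK0 : 0 < K := zero_lt_one.trans_le hK
  obtain ⟨M₁, hM₁⟩ := pressure_sup_le d k α hK hθ
  obtain ⟨M₂, hM₂⟩ := tensorPoly_sup_le_of_ball d k
    (show 0 < (R + 2) * σ by positivity) (show 0 < (K * κ * K) ^ d by positivity)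
  refine ⟨max M₁ (M₂ * M₁), fun N D nb t hbi hsh hnb hsize φ hφ a ha x hx => ?_⟩
  obtain ⟨q, hq, hgood, hbad⟩ := hφ
  have hinv : ∀ b, D.IsGood θ b → ∀ y ∈ D.cell b,
      ‖q b.1 y‖ₑ ^ 2 * volume (D.cell b) ≤ M₁ * D.partSq φ b := by
    intro b hb y hy
    have hv0 : volume (D.cell b) ≠ 0 := (hbi b.1).volume_elem_ne_zero b.2
    have hvt : volume (D.cell b) ≠ ⊤ := (hbi b.1).volume_elem_ne_top b.2
    have hvol : θ * volume (D.cell b) ≤ volume (D.part b) := by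
      have := hb.2
      rw [ENNReal.le_div_iff_mul_le (Or.inl hv0) (Or.inl hvt), ENNReal.ofReal_coe_nnreal,
        inter_comm] at this
      exact this
    have h1 := hM₁ (D.patch b.1) (hbi b.1) b.2 t (q b.1) (hq b.1) (D.part b) inter_subset_left
      (measurableSet_part hbi b) hvol y hy
    refine h1.trans_eq ?_
    rw [partSq]
    congr 1
    exact setLIntegral_congr_fun (measurableSet_part hbi b) fun z hz => by
      simp only [hgood b hb hz]
  by_cases hg : D.IsGood θ a
  · rw [source, if_pos hg, hgood a hg hx]
    refine (hinv a hg x hx.1).trans (mul_le_mul_left ?_ _)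
    exact_mod_cast le_max_left _ _
  · rw [source, if_neg hg]
    have hba : D.IsBad θ a := ⟨ha, hg⟩
    obtain ⟨-, hbg, hnei, -⟩ := hnb a hba
    obtain ⟨r, hr, hφr⟩ := hbad a hba
    set b := nb a with hb
    have hv0 : volume (D.cell b) ≠ 0 := (hbi b.1).volume_elem_ne_zero b.2
    have hvt : volume (D.cell b) ≠ ⊤ := (hbi b.1).volume_elem_ne_top b.2
    have hbm : MeasurableSet (D.cell b) := (hbi b.1).measurableSet_elem b.2
    have hqint : ∫⁻ y in D.cell b, ‖q b.1 y‖ₑ ^ 2 ≤ M₁ * D.partSq φ b := by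
      calc ∫⁻ y in D.cell b, ‖q b.1 y‖ₑ ^ 2
          ≤ ∫⁻ _ in D.cell b, M₁ * D.partSq φ b / volume (D.cell b) :=
            setLIntegral_mono' hbm fun y hy =>
              (ENNReal.le_div_iff_mul_le (Or.inl hv0) (Or.inl hvt)).2 (hinv b hbg y hy)
        _ = M₁ * D.partSq φ b := by
            rw [setLIntegral_const, ENNReal.div_mul_cancel hv0 hvt]
    obtain ⟨h, hh, hqh⟩ := (hbi b.1).exists_continuousOn_pressure hK b.2 (hq b.1)
    have hrint := (lintegral_proj_sq_le hbm ((hbi b.1).isCompact_image_cl b.2)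
      (Patch.elem_subset_image_cl b.2) hh hqh hr).trans hqint
    obtain ⟨y, hy, hdist⟩ := exists_dist_le_of_isNeighbor hbi hnei
    have hsb : 0 < D.size b := (hbi b.1).diam_elem_pos b.2
    have hsup := hM₂ r hr.1.mem_tensorPoly (D.cell b) y (D.size b) hsb hbm
      ((hbi b.1).diam_pow_le_volume (hsh b.1) b.2)
      (fun z hz => by
        have h1 : dist z y ≤ D.size b :=
          Metric.dist_le_diam_of_mem ((hbi b.1).isBounded_elem b.2) hz hy
        have h2 : (1 : ℝ) ≤ ((R + 2) * σ : ℝ≥0) := by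
          have : 1 ≤ (R + 2) * σ := by
            refine one_le_mul ?_ hσ
            exact (one_le_two).trans le_add_self
          exact_mod_cast this
        exact h1.trans (le_mul_of_one_le_left hsb.le h2))
      x (by
        refine (hdist x hx.1).trans ?_
        push_cast
        rw [mul_assoc]
        exact mul_le_mul_of_nonneg_left (hsize a hba) (by positivity))
    rw [hφr hx]
    calc ‖r x‖ₑ ^ 2 * volume (D.cell b) ≤ M₂ * (M₁ * D.partSq φ b) :=
          hsup.trans (mul_le_mul_right hrint _)
      _ = (M₂ * M₁ : ℝ≥0) * D.partSq φ b := by push_cast; ring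
      _ ≤ _ := mul_le_mul_left (by exact_mod_cast le_max_right _ _) _

/-! ### Mesh sizes on the interfaces -/

theorem size_nonneg (D : Overlap d k α N) (a : D.Elem) : 0 ≤ D.size a := Metric.diam_nonneg

theorem meshSize_le {i : Fin (N + 1)} {x : E d} {B : ℝ} (hB : 0 ≤ B)
    (h : ∀ J, x ∈ closure (D.part ⟨i, J⟩) → D.size ⟨i, J⟩ ≤ B) : D.meshSize i x ≤ B := by
  have hsum : ∑ J ∈ D.touching i x, D.size ⟨i, J⟩ ≤ (D.touching i x).card * B := by
    rw [← nsmul_eq_mul]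
    exact Finset.sum_le_card_nsmul _ _ _ fun J hJ => h J (mem_touching.1 hJ)
  rw [meshSize]
  rcases Nat.eq_zero_or_pos (D.touching i x).card with h0 | h0
  · rw [h0]; simpa using hB
  · have h0' : (0 : ℝ) < (D.touching i x).card := by exact_mod_cast h0
    rwa [inv_mul_le_iff₀ h0']

/-- The mesh size on an interface is at most a multiple of the size of every element that touches
it, from either side. -/
theorem ifaceSize_le (hbi : ∀ i, (D.patch i).BiLipschitz K) {c C : ℝ} (hc : 0 < c) (hC : 1 ≤ C)
    (hD : D.CompatibleSizes c C) {i j : Fin (N + 1)} (hij : j < i) {x : E d}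
    (hx : x ∈ D.iface i j) {a : D.Elem} (ha : a.1 = i ∨ a.1 = j) (hxa : x ∈ closure (D.part a)) :
    D.ifaceSize i j x ≤ C * (1 + c⁻¹) * D.size a := by
  obtain ⟨hxi, hxj⟩ := D.iface_subset_closure_visible i j hx
  have hcmp : ∀ J J', x ∈ closure (D.part ⟨i, J⟩) → x ∈ closure (D.part ⟨j, J'⟩) →
      D.size ⟨j, J'⟩ ≤ c⁻¹ * D.size ⟨i, J⟩ ∧ D.size ⟨i, J⟩ ≤ C * D.size ⟨j, J'⟩ := by
    intro J J' hJ hJ'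
    have h := hD ⟨i, J⟩ ⟨j, J'⟩ hij (isActive_of_mem_closure hJ) (isActive_of_mem_closure hJ')
      ⟨x, closure_mono inter_subset_left hJ, hx⟩ ⟨x, closure_mono inter_subset_left hJ', hx⟩
    exact ⟨by rw [le_inv_mul_iff₀ hc]; exact h.1, h.2⟩
  obtain ⟨Ji, hJi⟩ := touching_nonempty hbi hxi
  obtain ⟨Jj, hJj⟩ := touching_nonempty hbi hxj
  rw [mem_touching] at hJi hJj
  have hc' : 0 < c⁻¹ := inv_pos.2 hc
  have hB : 0 ≤ C * (1 + c⁻¹) * D.size a := by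
    have := D.size_nonneg a
    positivity
  have hCc : c⁻¹ ≤ C * (1 + c⁻¹) ∧ C ≤ C * (1 + c⁻¹) ∧ C * c⁻¹ ≤ C * (1 + c⁻¹) := by
    refine ⟨?_, ?_, ?_⟩ <;> nlinarith
  obtain ⟨l, J⟩ := a
  have hs := D.size_nonneg ⟨l, J⟩
  rw [ifaceSize]
  split_ifs with hl
  · refine meshSize_le hB fun J' hJ' => ?_
    rcases ha with rfl | rfl
    · exact (hcmp J J' hxa hJ').1.trans (mul_le_mul_of_nonneg_right hCc.1 hs)
    · have h1 := (hcmp Ji J' hJi hJ').1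
      have h2 := (hcmp Ji J hJi hxa).2
      calc D.size ⟨_, J'⟩ ≤ c⁻¹ * (C * D.size ⟨_, J⟩) :=
            h1.trans (mul_le_mul_of_nonneg_left h2 hc'.le)
        _ = C * c⁻¹ * D.size ⟨_, J⟩ := by ring
        _ ≤ _ := mul_le_mul_of_nonneg_right hCc.2.2 hs
  · refine meshSize_le hB fun J' hJ' => ?_
    rcases ha with rfl | rfl
    · have h1 := (hcmp J' Jj hJ' hJj).2
      have h2 := (hcmp J Jj hxa hJj).1
      calc D.size ⟨_, J'⟩ ≤ C * (c⁻¹ * D.size ⟨_, J⟩) :=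
            h1.trans (mul_le_mul_of_nonneg_left h2 (by linarith))
        _ = C * c⁻¹ * D.size ⟨_, J⟩ := by ring
        _ ≤ _ := mul_le_mul_of_nonneg_right hCc.2.2 hs
    · exact (hcmp J' J hJ' hxa).2.trans (mul_le_mul_of_nonneg_right hCc.2.1 hs)

/-- The surface measure of the part of an interface in the closure of the visible part of an
element, which may belong to any patch. -/
theorem iface_part_measure_le (d k α : ℕ) (hd : d ≠ 0) (K : ℝ≥0) : ∃ Cf : ℝ≥0,
    ∀ (N : ℕ) (D : Overlap d k α N), (∀ i, (D.patch i).BiLipschitz K) →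
      ∀ (i j : Fin (N + 1)) (a : D.Elem),
        (μHE[d - 1] : Measure (E d)) (closure (D.part a) ∩ D.iface i j) ≤
          Cf * ENNReal.ofReal (D.size a) ^ (d - 1) := by
  obtain ⟨Cf, hCf⟩ := frontier_measure_le d k α hd K
  refine ⟨Cf, fun N D hbi i j a => ?_⟩
  rcases (D.part a).eq_empty_or_nonempty with h | ⟨y, hy⟩
  · simp [h]
  · refine hCf (D.patch i) (hbi i) _ y (D.size a) (D.size_nonneg a) (fun x hx => hx.2.1.1) ?_
    refine inter_subset_left.trans (closure_minimal (fun x hx => ?_) Metric.isClosed_closedBall)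
    exact Metric.dist_le_diam_of_mem ((hbi a.1).isBounded_elem a.2) hx.1 hy.1

/-! ### The jumps of the stabilized pressures -/

open Classical in
/-- The squared norm of a pressure on the visible part of the good element that determines it on the
element `a`, and zero if `a` is not active. -/
def sourceSq (D : Overlap d k α N) (θ : ℝ) (nb : D.Elem → D.Elem) (φ : Fin (N + 1) → E d → ℝ)
    (a : D.Elem) : ℝ≥0∞ :=
  if D.IsActive a then D.partSq φ (D.source θ nb a) else 0

/-- The weighted jump on an interface is controlled by the elements of the two adjacent meshes: the
surface measure of the part of the interface in the closure of an element scales as `size ^ (d - 1)`,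
the weight as `size`, and the squared trace as `size ^ (-d)` times the squared norm. -/
theorem ifaceSq_jump_le (d k α : ℕ) [NeZero d] {K θ κ σ : ℝ≥0} (R : ℝ≥0) (hK : 1 ≤ K) (hθ : 0 < θ)
    (hσ : 1 ≤ σ) (hκ0 : 0 < κ) {c C : ℝ} (hc : 0 < c) (hC : 1 ≤ C) : ∃ M : ℝ≥0,
    ∀ (N : ℕ) (D : Overlap d k α N) (nb : D.Elem → D.Elem) (t : ElementType),
    (∀ i, (D.patch i).BiLipschitz K) → (∀ i, (D.patch i).ShapeRegular κ) →
    D.CompatibleSizes c C → D.IsGoodNeighborMap θ R nb →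
    (∀ a, D.IsBad θ a → D.size a ≤ σ * D.size (nb a)) →
    ∀ φ ∈ D.stabPres t θ nb, ∀ i j, j < i →
      D.ifaceSq 1 i j (fun x => D.trace i (φ i) x - D.trace j (φ j) x) ≤
        M * (∑ J, D.sourceSq θ nb φ ⟨i, J⟩ + ∑ J, D.sourceSq θ nb φ ⟨j, J⟩) := by
  obtain ⟨M₀, hM₀⟩ := stabPres_sup_le d k α (K := K) (θ := θ) (κ := κ) (σ := σ) R hK hθ hσ hκ0
  obtain ⟨Cf, hCf⟩ := iface_part_measure_le d k α (NeZero.ne d) K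
  set Cw : ℝ≥0 := (C * (1 + c⁻¹)).toNNReal with hCw
  have hCw' : ENNReal.ofReal (C * (1 + c⁻¹)) = Cw := rfl
  refine ⟨2 * Cw * Cf * σ ^ d * (K * κ * K) ^ d * M₀,
    fun N D nb t hbi hsh hcomp hnb hsize φ hφ i j hij => ?_⟩
  have hbound := hM₀ N D nb t hbi hsh hnb hsize φ hφ
  set M : ℝ≥0 := 2 * Cw * Cf * σ ^ d * (K * κ * K) ^ d * M₀ with hM
  set src := D.source θ nb with hsrc
  have hv0 : ∀ b, volume (D.cell b) ≠ 0 := fun b => (hbi b.1).volume_elem_ne_zero b.2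
  have hvt : ∀ b, volume (D.cell b) ≠ ⊤ := fun b => (hbi b.1).volume_elem_ne_top b.2
  set B : D.Elem → ℝ≥0∞ := fun a => M₀ * D.partSq φ (src a) / volume (D.cell (src a)) with hB
  have hφB : ∀ (l : Fin (N + 1)) (J), ∀ x ∈ D.part ⟨l, J⟩, ‖φ l x‖ₑ ^ 2 ≤ B ⟨l, J⟩ :=
    fun l J x hx => (ENNReal.le_div_iff_mul_le (Or.inl (hv0 _)) (Or.inl (hvt _))).2
      (hbound ⟨l, J⟩ ⟨x, hx⟩ x hx)
  set W : D.Elem → ℝ≥0∞ := fun a => 2 * (Cw * ENNReal.ofReal (D.size a)) * B a with hW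
  -- The contribution of one element.
  have hterm : ∀ a : D.Elem, W a * (μHE[d - 1] : Measure (E d)) (closure (D.part a) ∩ D.iface i j) ≤
      M * D.sourceSq θ nb φ a := by
    intro a
    by_cases ha : D.IsActive a
    · rw [sourceSq, if_pos ha]
      have hsz : D.size a ≤ σ * D.size (src a) := by
        by_cases hg : D.IsGood θ a
        · rw [hsrc, source, if_pos hg]
          exact le_mul_of_one_le_left (D.size_nonneg a) (by exact_mod_cast hσ)
        · rw [hsrc, source, if_neg hg]
          exact hsize a ⟨ha, hg⟩
      have hpow : ENNReal.ofReal (D.size a) ^ d ≤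
          (σ ^ d * (K * κ * K) ^ d : ℝ≥0) * volume (D.cell (src a)) := by
        calc ENNReal.ofReal (D.size a) ^ d ≤ (σ * ENNReal.ofReal (D.size (src a))) ^ d := by
              gcongr
              rw [← ENNReal.ofReal_coe_nnreal, ← ENNReal.ofReal_mul σ.coe_nonneg]
              exact ENNReal.ofReal_le_ofReal hsz
          _ = σ ^ d * ENNReal.ofReal (D.size (src a)) ^ d := mul_pow _ _ _
          _ ≤ σ ^ d * (((K * κ * K) ^ d : ℝ≥0) * volume (D.cell (src a))) :=
              mul_le_mul_right ((hbi _).diam_pow_le_volume (hsh _) _) _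
          _ = _ := by push_cast; ring
      have hd : d - 1 + 1 = d := Nat.succ_pred_eq_of_ne_zero (NeZero.ne d)
      calc W a * (μHE[d - 1] : Measure (E d)) (closure (D.part a) ∩ D.iface i j)
          ≤ W a * (Cf * ENNReal.ofReal (D.size a) ^ (d - 1)) :=
            mul_le_mul_right (hCf N D hbi i j a) _
        _ = 2 * Cw * Cf * B a * ENNReal.ofReal (D.size a) ^ (d - 1 + 1) := by
            rw [hW]; ring
        _ ≤ 2 * Cw * Cf * B a * ((σ ^ d * (K * κ * K) ^ d : ℝ≥0) * volume (D.cell (src a))) := by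
            rw [hd]; exact mul_le_mul_right hpow _
        _ = 2 * Cw * Cf * (σ ^ d * (K * κ * K) ^ d : ℝ≥0) * (B a * volume (D.cell (src a))) := by
            ring
        _ = M * D.partSq φ (src a) := by
            rw [hB, ENNReal.div_mul_cancel (hv0 _) (hvt _), hM]
            push_cast
            ring
    · have : D.part a = ∅ := not_nonempty_iff_eq_empty.1 ha
      simp [this]
  have hpt : ∀ x ∈ D.iface i j, ENNReal.ofReal (D.ifaceSize i j x ^ (1 : ℤ)) *
      ‖D.trace i (φ i) x - D.trace j (φ j) x‖ₑ ^ 2 ≤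
      (∑ J : (D.patch i).Idx, (closure (D.part ⟨i, J⟩)).indicator (fun _ => W ⟨i, J⟩) x) +
        ∑ J : (D.patch j).Idx, (closure (D.part ⟨j, J⟩)).indicator (fun _ => W ⟨j, J⟩) x := by
    intro x hx
    rw [← sum_touching i x fun J _ => W ⟨i, J⟩, ← sum_touching j x fun J _ => W ⟨j, J⟩, zpow_one]
    have hside : ∀ l, l = i ∨ l = j →
        ENNReal.ofReal (D.ifaceSize i j x) * (2 * ‖D.trace l (φ l) x‖ₑ ^ 2) ≤
          ∑ J ∈ D.touching l x, W ⟨l, J⟩ := by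
      intro l hl
      have h1 := (hasTraces_of_mem_stabPres hbi hK hφ l).enorm_trace_sq_le (hφB l) x
      calc ENNReal.ofReal (D.ifaceSize i j x) * (2 * ‖D.trace l (φ l) x‖ₑ ^ 2)
          ≤ ENNReal.ofReal (D.ifaceSize i j x) * (2 * ∑ J ∈ D.touching l x, B ⟨l, J⟩) := by
            gcongr
        _ = ∑ J ∈ D.touching l x, 2 * ENNReal.ofReal (D.ifaceSize i j x) * B ⟨l, J⟩ := by
            rw [← Finset.mul_sum]; ring
        _ ≤ _ := by
            refine Finset.sum_le_sum fun J hJ => ?_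
            have h2 := ifaceSize_le hbi hc hC hcomp hij hx (a := ⟨l, J⟩) hl (mem_touching.1 hJ)
            have h3 : ENNReal.ofReal (D.ifaceSize i j x) ≤ Cw * ENNReal.ofReal (D.size ⟨l, J⟩) := by
              rw [← hCw', ← ENNReal.ofReal_mul (by positivity)]
              exact ENNReal.ofReal_le_ofReal h2
            exact mul_le_mul_left (mul_le_mul_right h3 _) _
    calc _ ≤ ENNReal.ofReal (D.ifaceSize i j x) *
          (2 * ‖D.trace i (φ i) x‖ₑ ^ 2 + 2 * ‖D.trace j (φ j) x‖ₑ ^ 2) :=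
          mul_le_mul_right (enorm_sub_sq_le _ _) _
      _ ≤ _ := by
          rw [mul_add]
          exact add_le_add (hside i (Or.inl rfl)) (hside j (Or.inr rfl))
  have hmeas : ∀ l : Fin (N + 1), ∀ J : (D.patch l).Idx,
      Measurable ((closure (D.part ⟨l, J⟩)).indicator fun _ : E d => W ⟨l, J⟩) := fun l J =>
    measurable_const.indicator isClosed_closure.measurableSet
  have hint : ∀ l : Fin (N + 1), ∫⁻ x in D.iface i j, ∑ J : (D.patch l).Idx,
      (closure (D.part ⟨l, J⟩)).indicator (fun _ => W ⟨l, J⟩) x ∂μHE[d - 1] ≤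
        M * ∑ J, D.sourceSq θ nb φ ⟨l, J⟩ := by
    intro l
    rw [lintegral_finsetSum _ fun J _ => hmeas l J, Finset.mul_sum]
    refine Finset.sum_le_sum fun J _ => ?_
    rw [lintegral_indicator_const isClosed_closure.measurableSet,
      Measure.restrict_apply isClosed_closure.measurableSet]
    exact hterm ⟨l, J⟩
  rw [ifaceSq]
  refine (setLIntegral_mono' (D.measurableSet_iface i j) hpt).trans ?_
  rw [lintegral_add_left (Finset.measurable_fun_sum _ fun J _ => hmeas i J), mul_add]
  exact add_le_add (hint i) (hint j)

/-! ### Summation over the meshes and the interfaces -/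

theorem disjoint_part (hbi : ∀ i, (D.patch i).BiLipschitz K) (i : Fin (N + 1)) :
    Pairwise (Function.onFun Disjoint fun J => D.part ⟨i, J⟩) := fun _ _ h =>
  ((hbi i).disjoint_elem h).mono inter_subset_left inter_subset_left

theorem lintegral_iUnion_part (hbi : ∀ i, (D.patch i).BiLipschitz K) (i : Fin (N + 1))
    (φ : Fin (N + 1) → E d → ℝ) :
    ∫⁻ x in ⋃ J, D.part ⟨i, J⟩, ‖φ i x‖ₑ ^ 2 = ∑ J, D.partSq φ ⟨i, J⟩ := by
  rw [lintegral_iUnion (fun J => measurableSet_part hbi ⟨i, J⟩) (disjoint_part hbi i),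
    tsum_fintype]
  rfl

theorem sum_partSq_le (hbi : ∀ i, (D.patch i).BiLipschitz K) (φ : Fin (N + 1) → E d → ℝ) :
    ∑ b, D.partSq φ b ≤ ∑ i, D.presSq i (φ i) := by
  rw [Fintype.sum_sigma]
  refine Finset.sum_le_sum fun i _ => ?_
  rw [← lintegral_iUnion_part hbi]
  exact lintegral_mono_set (iUnion_subset fun J => inter_subset_right)

theorem partSq_ne_top (hbi : ∀ i, (D.patch i).BiLipschitz K) {φ : Fin (N + 1) → E d → ℝ}
    {b : D.Elem} (hφ : D.HasTraces b.1 (φ b.1)) : D.partSq φ b ≠ ⊤ := by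
  obtain ⟨h, hh, hφh⟩ := hφ b.2
  have hcpt : IsCompact (closure (D.part b)) :=
    (((hbi b.1).isBounded_elem b.2).subset inter_subset_left).isCompact_closure
  have hint : IntegrableOn (fun x => h x ^ 2) (D.part b) :=
    ((hh.pow 2).integrableOn_compact hcpt).mono_set subset_closure
  refine ne_top_of_le_ne_top hint.2.ne (le_of_eq ?_)
  exact setLIntegral_congr_fun (measurableSet_part hbi b) fun x hx => by
    simp only [hφh hx, enorm_pow]

/-- A function with traces is square integrable: it extends continuously to the compact closure of
the visible part of each element, and the mesh skeleton, where it is arbitrary, is a null set. -/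
theorem presSq_ne_top (hbi : ∀ i, (D.patch i).BiLipschitz K) {φ : Fin (N + 1) → E d → ℝ}
    {i : Fin (N + 1)} (hφ : D.HasTraces i (φ i)) : D.presSq i (φ i) ≠ ⊤ := by
  set Z := (D.patch i).domain \ ⋃ J, (D.patch i).elem J with hZ
  have hsub : D.visible i ⊆ (⋃ J, D.part ⟨i, J⟩) ∪ Z := by
    intro x hx
    by_cases h : x ∈ ⋃ J, (D.patch i).elem J
    · obtain ⟨J, hJ⟩ := mem_iUnion.1 h
      exact Or.inl (mem_iUnion.2 ⟨J, hJ, hx⟩)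
    · exact Or.inr ⟨hx.1, h⟩
  refine ne_top_of_le_ne_top ?_ ((lintegral_mono_set hsub).trans (lintegral_union_le _ _ _))
  rw [lintegral_iUnion_part hbi, setLIntegral_measure_zero _ _ (hbi i).volume_skeleton, add_zero]
  exact ENNReal.sum_ne_top.2 fun J _ => partSq_ne_top hbi (b := ⟨i, J⟩) hφ

/-- Every element is the source of at most `m + 1` active elements. -/
theorem sum_sourceSq_le {θ σ : ℝ} {nb : D.Elem → D.Elem} {m : ℕ}
    (hnb : D.NeighborBounds θ nb σ m) (φ : Fin (N + 1) → E d → ℝ) :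
    ∑ a, D.sourceSq θ nb φ a ≤ (m + 1) * ∑ b, D.partSq φ b := by
  classical
  simp only [sourceSq]
  rw [← Finset.sum_filter, ← Finset.sum_fiberwise _ (D.source θ nb), Finset.mul_sum]
  refine Finset.sum_le_sum fun b _ => ?_
  rw [Finset.sum_congr rfl fun a ha => by rw [(Finset.mem_filter.1 ha).2], Finset.sum_const,
    nsmul_eq_mul]
  refine mul_le_mul_left ?_ _
  have hcard : ({a ∈ ({a | D.IsActive a} : Finset D.Elem) | D.source θ nb a = b} :
      Finset D.Elem).card ≤ m + 1 := by
    have hsub : ({a ∈ ({a | D.IsActive a} : Finset D.Elem) | D.source θ nb a = b} :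
        Finset D.Elem) ⊆ insert b ({a | D.IsBad θ a ∧ nb a = b} : Finset D.Elem) := by
      intro a ha
      simp only [Finset.mem_filter, Finset.mem_univ, true_and] at ha
      rw [Finset.mem_insert, Finset.mem_filter]
      by_cases hg : D.IsGood θ a
      · rw [source, if_pos hg] at ha; exact Or.inl ha.2
      · rw [source, if_neg hg] at ha; exact Or.inr ⟨Finset.mem_univ _, ⟨ha.1, hg⟩, ha.2⟩
    refine (Finset.card_le_card hsub).trans ((Finset.card_insert_le _ _).trans ?_)
    have := hnb.2 b
    rw [Set.ncard_eq_toFinset_card'] at this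
    rw [toFinset_ofPred] at this
    omega
  exact_mod_cast hcard

/-- Summation of interface contributions: each patch takes part in a bounded number of them. -/
theorem sum_iface_le {nΓ : ℕ} (hn : D.numOverlaps ≤ nΓ) (g : Fin (N + 1) → Fin (N + 1) → ℝ≥0∞)
    (τ : Fin (N + 1) → ℝ≥0∞) (hg : ∀ i j, j < i → g i j ≤ τ i + τ j)
    (hg0 : ∀ i j, ¬ (D.iface i j).Nonempty → g i j = 0) :
    ∑ i, ∑ j ∈ Finset.Iio i, g i j ≤ 2 * nΓ * ∑ i, τ i := by
  classical
  have h1 : ∀ i, ((Finset.univ.filter fun j => j < i ∧ (D.iface i j).Nonempty).card : ℝ≥0∞) ≤ nΓ :=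
    fun i => by
      have := (le_max_left _ _).trans hn
      exact_mod_cast (Finset.le_sup (f := fun i =>
        (Finset.univ.filter fun j => j < i ∧ (D.iface i j).Nonempty).card)
        (Finset.mem_univ i)).trans (by convert this)
  have h2 : ∀ j, ((Finset.univ.filter fun i => j < i ∧ (D.iface i j).Nonempty).card : ℝ≥0∞) ≤ nΓ :=
    fun j => by
      have := (le_max_right _ _).trans hn
      exact_mod_cast (Finset.le_sup (f := fun j =>
        (Finset.univ.filter fun i => j < i ∧ (D.iface i j).Nonempty).card)
        (Finset.mem_univ j)).trans (by convert this)
  have hle : ∀ i j, (if j < i then g i j else 0) ≤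
      (if j < i ∧ (D.iface i j).Nonempty then τ i else 0) +
        (if j < i ∧ (D.iface i j).Nonempty then τ j else 0) := by
    intro i j
    by_cases hij : j < i
    · by_cases hne : (D.iface i j).Nonempty
      · simpa [hij, hne] using hg i j hij
      · simp [hij, hne, hg0 i j hne]
    · simp [hij]
  calc ∑ i, ∑ j ∈ Finset.Iio i, g i j = ∑ i, ∑ j, if j < i then g i j else 0 := by
        refine Finset.sum_congr rfl fun i _ => ?_
        rw [← Finset.sum_filter]
        exact Finset.sum_congr (by ext; simp) fun _ _ => rfl
    _ ≤ ∑ i, ∑ j, ((if j < i ∧ (D.iface i j).Nonempty then τ i else 0) +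
        (if j < i ∧ (D.iface i j).Nonempty then τ j else 0)) :=
        Finset.sum_le_sum fun i _ => Finset.sum_le_sum fun j _ => hle i j
    _ = (∑ i, ∑ j, if j < i ∧ (D.iface i j).Nonempty then τ i else 0) +
        ∑ j, ∑ i, if j < i ∧ (D.iface i j).Nonempty then τ j else 0 := by
        simp only [Finset.sum_add_distrib]
        rw [Finset.sum_comm (f := fun i j => if j < i ∧ (D.iface i j).Nonempty then τ j else 0)]
    _ ≤ (∑ i, nΓ * τ i) + ∑ j, nΓ * τ j := by
        refine add_le_add (Finset.sum_le_sum fun i _ => ?_) (Finset.sum_le_sum fun j _ => ?_)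
        · rw [← Finset.sum_filter, Finset.sum_const, nsmul_eq_mul]
          exact mul_le_mul_left (h1 i) _
        · rw [← Finset.sum_filter, Finset.sum_const, nsmul_eq_mul]
          exact mul_le_mul_left (h2 j) _
    _ = _ := by rw [← Finset.mul_sum]; ring

/-- Stability of the stabilized pressures: the jump terms are controlled by the `L²` norms. -/
theorem sum_ifaceSq_jump_le (d k α : ℕ) [NeZero d] {K θ κ σ : ℝ≥0} (R : ℝ≥0) (hK : 1 ≤ K)
    (hθ : 0 < θ) (hσ : 1 ≤ σ) (hκ0 : 0 < κ) {c C : ℝ} (hc : 0 < c) (hC : 1 ≤ C) (nΓ m : ℕ) :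
    ∃ M : ℝ≥0, ∀ (N : ℕ) (D : Overlap d k α N) (nb : D.Elem → D.Elem) (t : ElementType),
    (∀ i, (D.patch i).BiLipschitz K) → (∀ i, (D.patch i).ShapeRegular κ) →
    D.CompatibleSizes c C → D.IsGoodNeighborMap θ R nb → D.NeighborBounds θ nb σ m →
    D.numOverlaps ≤ nΓ → ∀ φ ∈ D.stabPres t θ nb,
      ∑ i, ∑ j ∈ Finset.Iio i,
        D.ifaceSq 1 i j (fun x => D.trace i (φ i) x - D.trace j (φ j) x) ≤
          M * ∑ i, D.presSq i (φ i) := by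
  obtain ⟨M, hM⟩ := ifaceSq_jump_le d k α (K := K) (θ := θ) (κ := κ) (σ := σ) R hK hθ hσ hκ0 hc hC
  refine ⟨2 * nΓ * (M * (m + 1)), fun N D nb t hbi hsh hcomp hnb hbd hn φ hφ => ?_⟩
  have hjump := hM N D nb t hbi hsh hcomp hnb hbd.1 φ hφ
  refine (sum_iface_le hn _ (fun i => M * ∑ J, D.sourceSq θ nb φ ⟨i, J⟩)
    (fun i j hij => (hjump i j hij).trans_eq (mul_add _ _ _)) fun i j hne => ?_).trans ?_
  · rw [ifaceSq, not_nonempty_iff_eq_empty.1 hne]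
    simp
  · rw [← Finset.mul_sum, ← Fintype.sum_sigma (fun a : D.Elem => D.sourceSq θ nb φ a)]
    calc 2 * (nΓ : ℝ≥0∞) * (M * ∑ a, D.sourceSq θ nb φ a)
        ≤ 2 * (nΓ : ℝ≥0∞) * (M * ((m + 1) * ∑ i, D.presSq i (φ i))) := by
          refine mul_le_mul_right (mul_le_mul_right ?_ _) _
          exact (sum_sourceSq_le hbd φ).trans (mul_le_mul_right (sum_partSq_le hbi φ) _)
      _ = _ := by push_cast; ring

/-! ### Velocities -/

theorem const_smul_mem_velSpace {t : ElementType} {i : Fin (N + 1)} {w : E d → E d}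
    (hw : w ∈ D.velSpace t i) (s : ℝ) : s • w ∈ D.velSpace t i := by
  obtain ⟨v, ⟨u, hu, hvu⟩, hwv⟩ := hw
  refine ⟨s • v, ⟨s • u, fun l => Submodule.smul_mem _ s (hu l), fun J ξ hξ => ?_⟩,
    fun x hx => by simp only [Pi.smul_apply, hwv hx]⟩
  have h := hvu J hξ
  cases t with
  | RT =>
    simp only [Patch.pullVel, Pi.smul_apply, map_smul] at h ⊢
    rw [smul_comm, h]
  | N =>
    simp only [Patch.pullVel, Pi.smul_apply, map_smul] at h ⊢
    rw [smul_comm, h]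
  | TH =>
    simp only [Patch.pullVel, Pi.smul_apply] at h ⊢
    rw [h]

theorem zero_mem_velSpace (D : Overlap d k α N) (t : ElementType) (i : Fin (N + 1)) :
    0 ∈ D.velSpace t i := by
  refine ⟨0, ⟨0, fun l => Submodule.zero_mem _, fun J ξ _ => ?_⟩, fun _ _ => rfl⟩
  cases t <;> simp [Patch.pullVel]

/-- The square of the local velocity norm. -/
def localVelSq (D : Overlap d k α N) (i : Fin (N + 1)) (v : E d → E d) : ℝ≥0∞ :=
  D.gradSq i v + ∑ l ∈ Finset.Ioi i, D.ifaceSq (-1) l i (D.trace i v) +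
    ∑ j ∈ Finset.Iio i, D.ifaceSq (-1) i j (D.trace i v)

theorem gradSq_const_smul (i : Fin (N + 1)) (v : E d → E d) (s : ℝ) :
    D.gradSq i (s • v) = ‖s‖ₑ ^ 2 * D.gradSq i v := by
  rw [gradSq, gradSq, ← lintegral_const_mul' _ _ (by finiteness)]
  refine lintegral_congr fun x => ?_
  rw [Finset.mul_sum]
  refine Finset.sum_congr rfl fun l _ => ?_
  rw [fderiv_const_smul_field, Pi.smul_apply, _root_.smul_apply, enorm_smul, mul_pow]

theorem ifaceSq_const_smul (z : ℤ) (i j : Fin (N + 1)) (g : E d → E d) (s : ℝ) :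
    D.ifaceSq z i j (s • g) = ‖s‖ₑ ^ 2 * D.ifaceSq z i j g := by
  rw [ifaceSq, ifaceSq, ← lintegral_const_mul' _ _ (by finiteness)]
  refine lintegral_congr fun x => ?_
  rw [Pi.smul_apply, enorm_smul, mul_pow, mul_left_comm]

theorem localVelSq_const_smul {i : Fin (N + 1)} {v : E d → E d} (hv : D.HasTraces i v) (s : ℝ) :
    D.localVelSq i (s • v) = ‖s‖ₑ ^ 2 * D.localVelSq i v := by
  have htr : D.trace i (s • v) = s • D.trace i v := funext fun x => trace_const_smul hv s x
  simp only [localVelSq, htr, gradSq_const_smul, ifaceSq_const_smul, mul_add, Finset.mul_sum]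

theorem divergence_const_smul (v : E d → E d) (s : ℝ) (x : E d) :
    divergence (s • v) x = s * divergence v x := by
  simp only [divergence, fderiv_const_smul_field, Pi.smul_apply, _root_.smul_apply,
    PiLp.smul_apply, smul_eq_mul, Finset.mul_sum]

theorem integral_divergence_const_smul (i : Fin (N + 1)) (q : E d → ℝ) (v : E d → E d) (s : ℝ) :
    ∫ x in D.visible i, q x * divergence (s • v) x =
      s * ∫ x in D.visible i, q x * divergence v x := by
  rw [← integral_const_mul]
  refine integral_congr_ae (Eventually.of_forall fun x => ?_)
  simp only [divergence_const_smul]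
  ring

theorem integral_divergence_eq_zero {i : Fin (N + 1)} {v : E d → E d} (hv : D.gradSq i v = 0)
    (q : E d → ℝ) : ∫ x in D.visible i, q x * divergence v x = 0 := by
  have hm : Measurable fun x => ∑ l, ‖fderiv ℝ v x (e l)‖ₑ ^ 2 :=
    Finset.measurable_fun_sum _ fun l _ => (measurable_fderiv_apply_const ℝ v (e l)).enorm.pow_const 2
  rw [gradSq, lintegral_eq_zero_iff hm] at hv
  refine integral_eq_zero_of_ae ?_
  filter_upwards [hv] with x hx
  have h : ∀ l, fderiv ℝ v x (e l) = 0 := fun l => by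
    have := (Finset.sum_eq_zero_iff.1 hx) l (Finset.mem_univ l)
    simpa using this
  simp [divergence, h]

/-- The broken norm of a tuple of velocities is controlled by the local norms, since the jump on an
interface is the difference of the two traces. -/
theorem velNorm_le (hbi : ∀ i, (D.patch i).BiLipschitz K) {t : ElementType}
    {v : Fin (N + 1) → E d → E d} (hv : v ∈ D.vel t) :
    D.velNorm v ≤ (2 * ∑ i, D.localVelSq i (v i)) ^ (1 / 2 : ℝ) := by
  have htr : ∀ i, Measurable (D.trace i (v i)) := fun i =>
    (hasTraces_of_mem_velSpace hbi (hv i)).measurable_trace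
  have hjump : ∀ i j, D.ifaceSq (-1) i j (fun x => D.trace i (v i) x - D.trace j (v j) x) ≤
      2 * D.ifaceSq (-1) i j (D.trace i (v i)) + 2 * D.ifaceSq (-1) i j (D.trace j (v j)) := by
    intro i j
    have hw : Measurable fun x => ENNReal.ofReal (D.ifaceSize i j x ^ (-1 : ℤ)) :=
      ((D.measurable_ifaceSize i j).pow_const (-1 : ℤ)).ennreal_ofReal
    have hm : Measurable fun x =>
        2 * (ENNReal.ofReal (D.ifaceSize i j x ^ (-1 : ℤ)) * ‖D.trace i (v i) x‖ₑ ^ 2) :=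
      (hw.mul ((htr i).enorm.pow_const 2)).const_mul 2
    simp only [ifaceSq]
    rw [← lintegral_const_mul' _ _ ENNReal.ofNat_ne_top,
      ← lintegral_const_mul' _ _ ENNReal.ofNat_ne_top, ← lintegral_add_left hm]
    refine lintegral_mono fun x => ?_
    refine (mul_le_mul_right (enorm_sub_sq_le _ _) _).trans (le_of_eq ?_)
    ring
  refine ENNReal.rpow_le_rpow ?_ (by norm_num)
  have hswap : ∑ i, ∑ j ∈ Finset.Iio i, D.ifaceSq (-1) i j (D.trace j (v j)) =
      ∑ i, ∑ l ∈ Finset.Ioi i, D.ifaceSq (-1) l i (D.trace i (v i)) :=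
    Finset.sum_comm' fun i j => by simp
  calc ∑ i, D.gradSq i (v i) + ∑ i, ∑ j ∈ Finset.Iio i,
        D.ifaceSq (-1) i j (fun x => D.trace i (v i) x - D.trace j (v j) x)
      ≤ 2 * ∑ i, D.gradSq i (v i) + ∑ i, ∑ j ∈ Finset.Iio i,
        (2 * D.ifaceSq (-1) i j (D.trace i (v i)) + 2 * D.ifaceSq (-1) i j (D.trace j (v j))) := by
        refine add_le_add (le_mul_of_one_le_left zero_le one_le_two) ?_
        exact Finset.sum_le_sum fun i _ => Finset.sum_le_sum fun j _ => hjump i j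
    _ = 2 * ∑ i, D.localVelSq i (v i) := by
        simp only [localVelSq, Finset.sum_add_distrib, ← Finset.mul_sum, hswap]
        ring

/-- The local inf-sup condition yields a velocity whose norm is at most that of the given pressure
and that tests it up to the inf-sup constant. The factor `1 / 2` makes up for a supremum that is
not attained. -/
theorem LocalInfSup.exists_velocity (hbi : ∀ i, (D.patch i).BiLipschitz K) {t : ElementType}
    {θ β : ℝ} (hβ : 0 < β) {nb : D.Elem → D.Elem} {i : Fin (N + 1)}
    (h : D.LocalInfSup t θ nb i β) {q : Fin (N + 1) → E d → ℝ} (hq : q ∈ D.stabPres t θ nb)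
    (hfin : D.presSq i (q i) ≠ ⊤) :
    ∃ v ∈ D.velSpace t i, D.localVelSq i v ≤ D.presSq i (q i) ∧
      ∫ x in D.visible i, q i x * divergence v x ≤ -(β / 2 * (D.presSq i (q i)).toReal) := by
  set p := D.presSq i (q i) with hp
  rcases eq_or_ne p 0 with hp0 | hp0
  · refine ⟨(0 : ℝ) • 0, const_smul_mem_velSpace (D.zero_mem_velSpace t i) 0, ?_, ?_⟩
    · rw [localVelSq_const_smul (hasTraces_of_mem_velSpace hbi (D.zero_mem_velSpace t i))]
      simp
    · rw [integral_divergence_const_smul, hp0]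
      simp
  set P := p.toReal with hP
  have hPpos : 0 < P := ENNReal.toReal_pos hp0 hfin
  have hsqrtP : p ^ (1 / 2 : ℝ) = ENNReal.ofReal (√P) := by
    rw [← ENNReal.ofReal_toReal hfin, ENNReal.ofReal_rpow_of_nonneg ENNReal.toReal_nonneg
      (by norm_num), Real.sqrt_eq_rpow]
  have hlt : ENNReal.ofReal (β / 2 * √P) < ENNReal.ofReal β * p ^ (1 / 2 : ℝ) := by
    rw [hsqrtP, ← ENNReal.ofReal_mul hβ.le, ENNReal.ofReal_lt_ofReal_iff (by positivity)]
    have : 0 < √P := Real.sqrt_pos.2 hPpos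
    nlinarith
  obtain ⟨v, hv⟩ := lt_iSup_iff.1 (hlt.trans_le (h q hq))
  obtain ⟨⟨hvV, hv0⟩, hv⟩ := lt_iSup_iff.1 hv
  have hnorm : D.localVelNorm i v = (D.localVelSq i v) ^ (1 / 2 : ℝ) := rfl
  set I := ∫ x in D.visible i, q i x * divergence v x with hI
  have hvt : D.localVelNorm i v ≠ ⊤ := fun h' => by
    rw [h', ENNReal.div_top] at hv
    exact not_lt_zero hv
  have hΛt : D.localVelSq i v ≠ ⊤ := fun h' => hvt (by
    rw [hnorm, h', ENNReal.top_rpow_of_pos (by norm_num)])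
  have hΛ0 : D.localVelSq i v ≠ 0 := fun h' => hv0 (by
    rw [hnorm, h', ENNReal.zero_rpow_of_pos (by norm_num)])
  set Λ := (D.localVelSq i v).toReal with hΛ
  have hΛpos : 0 < Λ := ENNReal.toReal_pos hΛ0 hΛt
  have hsqrtΛ : D.localVelNorm i v = ENNReal.ofReal (√Λ) := by
    rw [hnorm, ← ENNReal.ofReal_toReal hΛt, ENNReal.ofReal_rpow_of_nonneg ENNReal.toReal_nonneg
      (by norm_num), Real.sqrt_eq_rpow]
  have hΛs : 0 < √Λ := Real.sqrt_pos.2 hΛpos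
  have hPs : 0 < √P := Real.sqrt_pos.2 hPpos
  have hIlow : β / 2 * √P * √Λ < I := by
    rw [ENNReal.lt_div_iff_mul_lt (Or.inl hv0) (Or.inl hvt), hsqrtΛ,
      ← ENNReal.ofReal_mul (by positivity)] at hv
    exact (ENNReal.ofReal_lt_ofReal_iff_of_nonneg (by positivity)).1 hv
  -- The scaling makes the norms of velocity and pressure equal.
  refine ⟨(-(√P / √Λ)) • v, const_smul_mem_velSpace hvV _, ?_, ?_⟩
  · rw [localVelSq_const_smul (hasTraces_of_mem_velSpace hbi hvV), ← ENNReal.ofReal_toReal hΛt,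
      ← hΛ, ← ofReal_norm, ← ENNReal.ofReal_pow (norm_nonneg _),
      ← ENNReal.ofReal_mul (by positivity), ← ENNReal.ofReal_toReal hfin, ← hP]
    refine ENNReal.ofReal_le_ofReal (le_of_eq ?_)
    rw [norm_neg, Real.norm_eq_abs, sq_abs, div_pow, Real.sq_sqrt hPpos.le, Real.sq_sqrt hΛpos.le]
    field_simp
  · rw [integral_divergence_const_smul, ← hI]
    have h1 : β / 2 * P = √P / √Λ * (β / 2 * √P * √Λ) := by
      nth_rw 1 [← Real.mul_self_sqrt hPpos.le]
      field_simp
    rw [h1, neg_mul, neg_le_neg_iff]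
    exact mul_le_mul_of_nonneg_left hIlow.le (by positivity)

/-- The local inf-sup conditions and the stability of the pressure jumps with constant `M` give the
global inf-sup condition. -/
theorem le_infSup (hbi : ∀ i, (D.patch i).BiLipschitz K) (hK : 1 ≤ K) {t : ElementType}
    {θ β : ℝ} (hβ : 0 < β) {nb : D.Elem → D.Elem} (h : ∀ i, D.LocalInfSup t θ nb i β) {M : ℝ≥0}
    {q : Fin (N + 1) → E d → ℝ} (hq : q ∈ D.stabPres t θ nb) (hq0 : D.presNorm q ≠ 0)
    (hM : ∑ i, ∑ j ∈ Finset.Iio i,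
      D.ifaceSq 1 i j (fun x => D.trace i (q i) x - D.trace j (q j) x) ≤
        M * ∑ i, D.presSq i (q i)) :
    ENNReal.ofReal (β / 2 / (2 + M)) ≤ ⨆ v ∈ {v ∈ D.vel t | D.velNorm v ≠ 0},
      ENNReal.ofReal (D.bForm v q) / (D.velNorm v * D.presNorm q) := by
  have hfin : ∀ i, D.presSq i (q i) ≠ ⊤ := fun i =>
    presSq_ne_top hbi (hasTraces_of_mem_stabPres hbi hK hq i)
  choose v hvV hvn hvI using fun i => (h i).exists_velocity hbi hβ hq (hfin i)
  set X := ∑ i, D.presSq i (q i) with hX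
  have hXt : X ≠ ⊤ := ENNReal.sum_ne_top.2 fun i _ => hfin i
  have hXr : X.toReal = ∑ i, (D.presSq i (q i)).toReal :=
    ENNReal.toReal_sum fun i _ => hfin i
  -- Both squared norms are at most `(2 + M) X`.
  set A : ℝ≥0∞ := (2 + M) * X with hA
  have hAt : A ≠ ⊤ := ENNReal.mul_ne_top (by finiteness) hXt
  have hvel : D.velNorm v ≤ A ^ (1 / 2 : ℝ) := by
    refine (velNorm_le hbi hvV).trans (ENNReal.rpow_le_rpow ?_ (by norm_num))
    exact mul_le_mul' le_self_add (Finset.sum_le_sum fun i _ => hvn i)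
  have hpres : D.presNorm q ≤ A ^ (1 / 2 : ℝ) := by
    refine ENNReal.rpow_le_rpow ?_ (by norm_num)
    calc X + _ ≤ X + M * X := add_le_add le_rfl hM
      _ = (1 + M) * X := by ring
      _ ≤ A := mul_le_mul_left (add_le_add one_le_two le_rfl) _
  have hA0 : A ≠ 0 := fun h0 => hq0 (by
    rw [h0, ENNReal.zero_rpow_of_pos (by norm_num)] at hpres
    exact le_zero_iff.1 hpres)
  have hX0 : X ≠ 0 := fun h0 => hA0 (by rw [hA, h0, mul_zero])
  have hXpos : 0 < X.toReal := ENNReal.toReal_pos hX0 hXt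
  have hb : β / 2 * X.toReal ≤ D.bForm v q := by
    rw [bForm, le_neg, hXr, Finset.mul_sum, ← Finset.sum_neg_distrib]
    exact Finset.sum_le_sum fun i _ => hvI i
  have hv0 : D.velNorm v ≠ 0 := fun h0 => by
    rw [velNorm, ENNReal.rpow_eq_zero_iff_of_pos (by norm_num), add_eq_zero,
      Finset.sum_eq_zero_iff] at h0
    have hb0 : D.bForm v q = 0 := by
      rw [bForm, Finset.sum_eq_zero fun i hi => integral_divergence_eq_zero (h0.1 i hi) _, neg_zero]
    rw [hb0] at hb
    exact absurd hb (not_le.2 (by positivity))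
  have hhalf : A ^ (1 / 2 : ℝ) ≠ ⊤ := ENNReal.rpow_ne_top_of_nonneg (by norm_num) hAt
  have hprod : D.velNorm v * D.presNorm q ≤ A := by
    refine (mul_le_mul' hvel hpres).trans (le_of_eq ?_)
    rw [← ENNReal.rpow_add_of_nonneg _ _ (by norm_num) (by norm_num)]
    norm_num
  refine le_trans ?_ (le_iSup₂_of_le v ⟨hvV, hv0⟩ le_rfl)
  rw [ENNReal.le_div_iff_mul_le (Or.inl (mul_ne_zero hv0 hq0))
    (Or.inl (ne_top_of_le_ne_top hAt hprod))]
  calc ENNReal.ofReal (β / 2 / (2 + M)) * (D.velNorm v * D.presNorm q)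
      ≤ ENNReal.ofReal (β / 2 / (2 + M)) * A := mul_le_mul_right hprod _
    _ = ENNReal.ofReal (β / 2 * X.toReal) := by
        have h2 : (2 + M : ℝ≥0∞) = ENNReal.ofReal (2 + M) := by
          rw [ENNReal.ofReal_add zero_le_two M.coe_nonneg, ENNReal.ofReal_ofNat,
            ENNReal.ofReal_coe_nnreal]
        have h3 : (0 : ℝ) < 2 + M := by positivity
        rw [hA, h2, ← ENNReal.ofReal_toReal hXt, ENNReal.toReal_ofReal hXpos.le,
          ← ENNReal.ofReal_mul h3.le, ← ENNReal.ofReal_mul (by positivity)]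
        congr 1
        field_simp
    _ ≤ ENNReal.ofReal (D.bForm v q) := ENNReal.ofReal_le_ofReal hb

/-- A negative `R` acts like `0`, since the distance bound is truncated to `ℝ≥0∞`. -/
theorem isNeighbor_toNNReal (D : Overlap d k α N) (R : ℝ) (a b : D.Elem) :
    D.IsNeighbor R.toNNReal a b ↔ D.IsNeighbor R a b := by
  rw [IsNeighbor, IsNeighbor, ENNReal.ofReal_mul' (D.size_nonneg a),
    ENNReal.ofReal_mul' (D.size_nonneg a), ENNReal.ofReal_coe_nnreal]
  rfl

end Overlap

end OverlapStokes

end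

theorem mainTheorem4
    (d : ℕ) (hd : d = 2 ∨ d = 3) (t : OverlapStokes.ElementType) (k α : ℕ) (hα : α < k)
    (θ : ℝ) (hθ : 0 < θ) (hθ1 : θ ≤ 1)
    (L κ R c C σ : ℝ) (hc : 0 < c) (nΓ m : ℕ) (β : ℝ) (hβ : 0 < β) :
    ∃ β₀ : ℝ, 0 < β₀ ∧
      ∀ (N : ℕ) (D : OverlapStokes.Overlap d k α N) (nb : D.Elem → D.Elem),
        (∀ i, (D.patch i).BiLipschitz L) →
        (∀ i, (D.patch i).ShapeRegular κ) →
        D.CompatibleSizes c C →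
        D.IsGoodNeighborMap θ R nb →
        D.NeighborBounds θ nb σ m →
        D.numOverlaps ≤ nΓ →
        (∀ i, D.LocalInfSup t θ nb i β) →
        ENNReal.ofReal β₀ ≤
          ⨅ q ∈ {q ∈ D.stabPres t θ nb | D.presNorm q ≠ 0},
            ⨆ v ∈ {v ∈ D.vel t | D.velNorm v ≠ 0},
              ENNReal.ofReal (D.bForm v q) / (D.velNorm v * D.presNorm q) := by
  have : NeZero d := ⟨by omega⟩
  -- The hypotheses are monotone in `L`, `κ`, `C` and `σ`, which may thus be taken at least `1`.
  have hone : ∀ x : ℝ, 1 ≤ (max x 1).toNNReal := fun x => by simp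
  have hcoe : ∀ x : ℝ, ((max x 1).toNNReal : ℝ) = max x 1 := fun x =>
    Real.coe_toNNReal _ (zero_le_one.trans (le_max_right _ _))
  have hθ' : (θ.toNNReal : ℝ) = θ := Real.coe_toNNReal _ hθ.le
  obtain ⟨M, hM⟩ := OverlapStokes.Overlap.sum_ifaceSq_jump_le d k α R.toNNReal (hone L)
    (Real.toNNReal_pos.2 hθ) (hone σ) (zero_lt_one.trans_le (hone κ)) hc (le_max_right C 1) nΓ m
  refine ⟨β / 2 / (2 + M), by positivity,
    fun N D nb hbi hsh hcomp hnb hbd hn hloc => le_iInf₂ fun q hq => ?_⟩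
  have hbi' : ∀ i, (D.patch i).BiLipschitz (max L 1).toNNReal := fun i x hx y hy => by
    rw [hcoe]
    exact ⟨(hbi i x hx y hy).1.trans (mul_le_mul_of_nonneg_right (le_max_left _ _) dist_nonneg),
      (hbi i x hx y hy).2.trans (mul_le_mul_of_nonneg_right (le_max_left _ _) dist_nonneg)⟩
  have hsh' : ∀ i, (D.patch i).ShapeRegular (max κ 1).toNNReal := fun i J l => by
    rw [hcoe]
    exact (hsh i J l).trans (mul_le_mul_of_nonneg_right (le_max_left _ _)
      (sub_nonneg.2 ((D.patch i).lo_lt_hi J l).le))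
  have hcomp' : D.CompatibleSizes c (max C 1) := fun a b hab ha hb h1 h2 =>
    ⟨(hcomp a b hab ha hb h1 h2).1, (hcomp a b hab ha hb h1 h2).2.trans
      (mul_le_mul_of_nonneg_right (le_max_left _ _) (D.size_nonneg b))⟩
  have hnb' : D.IsGoodNeighborMap θ.toNNReal R.toNNReal nb := by
    rw [hθ']
    intro a ha
    simpa only [D.isNeighbor_toNNReal] using hnb a ha
  have hbd' : D.NeighborBounds θ.toNNReal nb (max σ 1).toNNReal m := by
    rw [hθ', hcoe]
    exact ⟨fun a ha => (hbd.1 a ha).trans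
      (mul_le_mul_of_nonneg_right (le_max_left _ _) (D.size_nonneg _)), hbd.2⟩
  exact OverlapStokes.Overlap.le_infSup hbi' (hone L) hβ hloc hq.1 hq.2
    (hM N D nb t hbi' hsh' hcomp' hnb' hbd' hn q (by rw [hθ']; exact hq.1))
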